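/- **Theorem (Recursive formula for moments).** An $m\times n$ complex matrix $F=[\mathbf f_1\cdots\mathbf f_n]$ is an equiangular tight frame (ETF) if there are constants $\nu,\rho\ge 0$ such that $|\langle \mathbf f_i,\mathbf f_j\rangle|=1$ for $i=j$, $|\langle \mathbf f_i,\mathbf f_j\rangle|=\nu$ for $i\ne j$, and $FF^\dagger=\rho I_m$. (Real ETFs are included.) For $p\in[0,1]$ let $P=\mathrm{diag}[P_1,\dots,P_n]$ with independent Bernoulli$(p)$ entries, and for $r\ge 1$ let $$m_r(F,p)=\frac1n\,\mathbb E\bigl[\operatorname{trace}\bigl((FPF^\dagger)^r\bigr)\bigr]$$ be the expected $r$-th moment of a random subset of $F$. Fix $0<\gamma<1$. Define real numbers $A_1,A_2,\dots$ by $$A_1=\frac{2-\gamma^{-1}}{2\sqrt{\gamma^{-1}-1}},\qquad A_2=1,\qquad A_{s+1}=-\sum_{i=1}^{s}A_iA_{s+1-i}\quad(s=2,3,\dots).$$ Let $\Pi(r,t)$ be the set of partitions of $[r]=\{1,\dots,r\}$ into $t$ non-empty blocks. A partition is crossing if there are two distinct blocks $\mathcal A,\mathcal B$ and elements $a_1,a_2\in\mathcal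 A$, $b_1,b_2\in\mathcal B$ with $a_1<b_1<a_2<b_2$. For $\pi\in\Pi(r,t)$ let $G(\pi)$ be the directed multigraph whose $t$ vertices are the blocks of $\pi$ and whose $r$ edges are the steps $1\to2,\ 2\to3,\ \dots,\ r\to1$, each step joining the block of its starting element to the block of its final element (for $r=1$, a single loop). For non-crossing $\pi$ this graph is a cactus, and $\mathrm{cyc}(\pi)$ denotes the multiset of lengths of its cycles (closed directed paths that repeat no vertex, identified with their edge sets; loops are cycles of length $1$). Put $$V^*(\pi,\gamma)=\begin{cases}\prod_{s\in\mathrm{cyc}(\pi)}A_s,&\pi\text{ non-crossing},\\ 0,&\pi\text{ crossing},\end{cases}\qquad m^{\rm central}_r(\gamma,p)=\sum_{t=1}^r\Bigl(\sum_{\pi\in\Pi(r,t)}V^*(\pi,\gamma)\Bigr)p^t,$$ $$m^*_r(\gamma,p)=\Bigl(\frac{\gamma^{-1}}2\Bigr)^r p+\sum_{j=1}^r\binom rj(\gamma^{-1}-1)^{j/2}\Bigl(\frac{\gamma^{-1}}2\Bigr)^{r-j}m^{\rm central}_j(\gamma,p).$$ Let $F_1,F_2,\dots$ be any sequence in which $F_i$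 is an $m_i\times n_i$ ETF, with $n_i\to\infty$ and $m_i/n_i\to\gamma$. Then for every $p\in[0,1]$ and every $r\ge1$ the limit $\lim_{i\to\infty}m_r(F_i,p)$ exists and equals $m^*_r(\gamma,p)$; in particular it depends only on $\gamma,p,r$ and not on the sequence of ETFs. -/

import Mathlib

open Filter Topology MeasureTheory ProbabilityTheory
open scoped Matrix

noncomputable section

namespace ETFMoments

/-! ### Equiangular tight frames and random subsets -/

/-- The columns of the `m × n` complex matrix `F` form an equiangular tight frame: the absolute
inner products of the columns are `1` on the diagonal and a constant `ν ≥ 0` off the diagonal, and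
`F F† = ρ I` for a constant `ρ ≥ 0`. -/
def IsETF {m n : ℕ} (F : Matrix (Fin m) (Fin n) ℂ) : Prop :=
  ∃ ν ρ : ℝ, 0 ≤ ν ∧ 0 ≤ ρ ∧
    (∀ i j, ‖(Fᴴ * F) i j‖ = if i = j then 1 else ν) ∧
    F * Fᴴ = (ρ : ℂ) • (1 : Matrix (Fin m) (Fin m) ℂ)

open Classical in
/-- The diagonal `0/1` selection matrix of a subset `S` of the columns. -/
def selection {n : ℕ} (S : Set (Fin n)) : Matrix (Fin n) (Fin n) ℂ :=
  Matrix.diagonal fun i => if i ∈ S then 1 else 0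

/-- The expected `r`-th moment `(1/n) 𝔼[trace((F P F†)^r)]`, where `P` is the selection matrix of
a random subset containing each of the `n` columns independently with probability `p`. -/
def expectedMoment {m n : ℕ} (F : Matrix (Fin m) (Fin n) ℂ) (p : unitInterval) (r : ℕ) : ℂ :=
  (1 / (n : ℂ)) *
    ∫ S, ((F * selection S * Fᴴ) ^ r).trace ∂(setBernoulli (Set.univ : Set (Fin n)) p)

/-! ### The sequence of cycle values -/

/-- The values `A_s` of cycles of length `s` (the value at `s = 0` plays no role). -/
def A (γ : ℝ) : ℕ → ℝ
  | 0 => 0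
  | 1 => (2 - γ⁻¹) / (2 * √(γ⁻¹ - 1))
  | 2 => 1
  | s + 3 => - ∑ i : Fin (s + 2), A γ (i.val + 1) * A γ (s + 2 - i.val)
termination_by s => s

theorem A_one (γ : ℝ) : A γ 1 = (2 - γ⁻¹) / (2 * √(γ⁻¹ - 1)) := by rw [A]

theorem A_two (γ : ℝ) : A γ 2 = 1 := by rw [A]

/-- The recursive relation `A_{s+1} = -∑_{i=1}^{s} A_i A_{s+1-i}` for `s = 2, 3, …`. -/
theorem A_succ (γ : ℝ) (s : ℕ) (hs : 2 ≤ s) :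
    A γ (s + 1) = - ∑ i ∈ Finset.Icc 1 s, A γ i * A γ (s + 1 - i) := by
  obtain ⟨k, rfl⟩ := Nat.exists_eq_add_of_le hs
  have h1 : 2 + k + 1 = k + 3 := by omega
  rw [h1, A, Fin.sum_univ_eq_sum_range (fun i => A γ (i + 1) * A γ (k + 2 - i)) (k + 2)]
  congr 1
  refine Finset.sum_nbij' (fun i => i + 1) (fun i => i - 1) ?_ ?_ ?_ ?_ ?_
  · intro i hi; simp only [Finset.mem_range, Finset.mem_Icc] at *; omega
  · intro i hi; simp only [Finset.mem_range, Finset.mem_Icc] at *; omega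
  · intro i _; simp
  · intro i hi; exact Nat.sub_add_cancel (Finset.mem_Icc.mp hi).1
  · intro i _
    congr 2
    omega

/-! ### Partitions of `[r]` and their graphs -/

/-- Partitions of `[r] = {1, …, r}`, indexed here by `0, …, r - 1`. -/
abbrev Part (r : ℕ) : Type := Finpartition (Finset.univ : Finset (Fin r))

/-- A partition is crossing if `a₁ < b₁ < a₂ < b₂` for some `a₁, a₂` in one block and `b₁, b₂` in
another block. -/
def IsCrossing {r : ℕ} (π : Part r) : Prop :=
  ∃ B ∈ π.parts, ∃ C ∈ π.parts, B ≠ C ∧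
    ∃ a₁ ∈ B, ∃ a₂ ∈ B, ∃ b₁ ∈ C, ∃ b₂ ∈ C, a₁ < b₁ ∧ b₁ < a₂ ∧ a₂ < b₂

/-- The graph `G(π)` is the multigraph whose vertices are the blocks of `π` and whose `r` edges are
the steps `1 → 2, 2 → 3, …, r → 1`: the edge `e : Fin r` starts at the block of `e`. -/
def edgeSource {r : ℕ} (π : Part r) (e : Fin r) : Finset (Fin r) := π.part e

/-- The edge `e : Fin r` of `G(π)` ends at the block of the cyclic successor of `e`. -/
def edgeTarget {r : ℕ} (π : Part r) (e : Fin r) : Finset (Fin r) := π.part (finRotate r e)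

/-- `E` is the edge set of a cycle of length `s ≥ 1` in `G(π)`: its edges are `c 0, …, c (s - 1)`,
the end of each of them is the start of the next one (cyclically), and no vertex is visited twice.
A cycle of length `1` is a loop. -/
def IsCycle {r : ℕ} (π : Part r) (E : Finset (Fin r)) : Prop :=
  ∃ (s : ℕ) (c : Fin s → Fin r), 0 < s ∧
    (∀ k, edgeTarget π (c k) = edgeSource π (c (finRotate s k))) ∧
    Function.Injective (fun k => edgeSource π (c k)) ∧
    E = Finset.univ.image c

open Classical in
/-- The set of all cycles of `G(π)`, each represented by its set of edges, so that the length of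
a cycle is the number of its elements. -/
def cycles {r : ℕ} (π : Part r) : Finset (Finset (Fin r)) :=
  Finset.univ.filter (IsCycle π)

open Classical in
/-- The value `V*(π, γ)` of a partition: the product of the values of the cycles of `G(π)`, with
multiplicity, if `π` is non-crossing, and zero otherwise. -/
def value {r : ℕ} (π : Part r) (γ : ℝ) : ℝ :=
  if IsCrossing π then 0 else ∏ E ∈ cycles π, A γ E.card

/-! ### The recursive procedure -/

/-- The centralized quantity: the sum over `t = 1, …, r` of `p ^ t` times the total value of the
partitions of `[r]` into `t` blocks. -/
def mCentral (r : ℕ) (γ p : ℝ) : ℝ :=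
  ∑ t ∈ Finset.Icc 1 r, (∑ π : Part r with π.parts.card = t, value π γ) * p ^ t

/-- The coefficient `K_{r,j}` of the decentralization formula. -/
def K (r j : ℕ) (γ p : ℝ) : ℝ :=
  (γ⁻¹ - 1) ^ ((j : ℝ) / 2) * (γ⁻¹ / 2) ^ (r - j) * mCentral j γ p

/-- The output `m*_r(γ, p)` of the recursive procedure. -/
def mStar (r : ℕ) (γ p : ℝ) : ℝ :=
  (γ⁻¹ / 2) ^ r * p + ∑ j ∈ Finset.Icc 1 r, (r.choose j : ℝ) * K r j γ p

end ETFMoments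

end

/-! For an ETF with ρ = n/m, the Gram matrix G = F†F satisfies G² = ρG, has unit diagonal, and its
off-diagonal entries have squared modulus (ρ - 1)/(n - 1). Its eigenvalues lie in {0, ρ}, symmetric
about ρ/2, so H = (G - ρ/2)/√(ρ - 1) has a scalar square c, a constant diagonal a and off-diagonal
entries of order n^(-1/2). As ρ → γ⁻¹, a → A_1 and c → 1 + A_1². A binomial expansion
(`trace_moment`) reduces the moments of F to those of H, and these are sums over partitions s of
p^(number of blocks) times a partition sum: the normalized sum of products of entries of H over
closed walks whose coincidences are exactly s (`integral_trace_pow`).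

The core is that every partition sum converges to V* (`tendsto_partitionSum`), by induction on r
and, for fixed r, from coarse partitions to fine ones. Everything is invariant under rotation. If
two cyclically adjacent elements are equivalent, the loop contributes a factor a and r drops. If
some block is a singleton, letting its vertex run freely turns its two edges into an entry of H² =
c; the unwanted terms attach that vertex to another block, so they belong to coarser partitions. If
neither occurs, the partition is crossing (`exists_loop_or_singleton`) and has t ≤ r/2 blocks; at
most n^t walks of size O(n^(-r/2)), divided by n, give O(1/n).

The values V* obey the same rules. The cycles of a non-crossing G(π) are the classes of the Kreweras
complement (`isCycle_iff`). A new last element either lengthens the cycle through the last edge, of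
length l say, or pinches it into two. Hence the values of all extensions sum to a common factor
times A_{l+1} + ∑_{i=1}^{l} A_i A_{l+1-i}, which vanishes for l ≥ 2 by the recursion and equals 1 +
A_1² for l = 1 (`sum_setoidValue_extensions`). -/

namespace ETFMoments

/-! ### Partitions as equivalence relations, and the Kreweras complement -/

/-- A setoid on `Fin r` is crossing if `a < b < c < d` with `a ∼ c`, `b ∼ d` and `a ≁ b`. -/
def Crossing {r : ℕ} (s : Setoid (Fin r)) : Prop :=
  ∃ a b c d, a < b ∧ b < c ∧ c < d ∧ s a c ∧ s b d ∧ ¬ s a b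

/-- The Kreweras complement: edges `e ≤ f` are equivalent if the interval `(e, f]` is a union of
blocks. Membership in the interval is expressed symmetrically in `e` and `f`. -/
def kreweras {r : ℕ} (s : Setoid (Fin r)) : Setoid (Fin r) where
  r e f := ∀ x y, s x y → ((x ≤ e ↔ x ≤ f) ↔ (y ≤ e ↔ y ≤ f))
  iseqv :=
    { refl := fun e x y _ => by tauto
      symm := fun h x y hxy => by have := h x y hxy; tauto
      trans := fun h h' x y hxy => by have := h x y hxy; have := h' x y hxy; tauto }

theorem kreweras_iff {r : ℕ} {s : Setoid (Fin r)} {e f : Fin r} :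
    kreweras s e f ↔ ∀ x y, s x y → ((x ≤ e ↔ x ≤ f) ↔ (y ≤ e ↔ y ≤ f)) := Iff.rfl

open Classical in
/-- The equivalence class of an element, as a finset. -/
noncomputable def eqvClass {r : ℕ} (s : Setoid (Fin r)) (e : Fin r) : Finset (Fin r) :=
  Finset.univ.filter fun f => s e f

@[simp]
theorem mem_eqvClass {r : ℕ} {s : Setoid (Fin r)} {e f : Fin r} : f ∈ eqvClass s e ↔ s e f := by
  simp [eqvClass]

theorem eqvClass_eq_iff {r : ℕ} {s : Setoid (Fin r)} {e f : Fin r} :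
    eqvClass s e = eqvClass s f ↔ s e f := by
  constructor
  · intro h
    have : f ∈ eqvClass s f := by simp
    rw [← h] at this
    simpa using this
  · intro h
    ext g
    simp only [mem_eqvClass]
    exact ⟨fun h' => s.trans (s.symm h) h', fun h' => s.trans h h'⟩

open Classical in
/-- The product of the values of the classes of the Kreweras complement. -/
noncomputable def weight (γ : ℝ) {r : ℕ} (s : Setoid (Fin r)) : ℝ :=
  ∏ E ∈ Finset.univ.image (eqvClass (kreweras s)), A γ E.card

open Classical in
/-- The value of a partition, in terms of the Kreweras complement. -/
noncomputable def setoidValue (γ : ℝ) {r : ℕ} (s : Setoid (Fin r)) : ℝ :=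
  if Crossing s then 0 else weight γ s

-- Each class is represented by its largest edge. A product over edges, unlike one over a set of
-- classes, can be compared factor by factor when an element is added or removed.
open Classical in
theorem weight_eq_prod (γ : ℝ) {r : ℕ} (s : Setoid (Fin r)) :
    weight γ s = ∏ e, if ∀ f, kreweras s e f → f ≤ e then A γ (eqvClass (kreweras s) e).card
      else 1 := by
  rw [weight, ← Finset.prod_filter]
  have : (Finset.univ.image (eqvClass (kreweras s))) =
      (Finset.univ.filter fun e => ∀ f, kreweras s e f → f ≤ e).image (eqvClass (kreweras s)) := by
    ext E
    simp only [Finset.mem_image, Finset.mem_univ, true_and, Finset.mem_filter]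
    constructor
    · rintro ⟨e, rfl⟩
      have hne : (eqvClass (kreweras s) e).Nonempty := ⟨e, by simp⟩
      refine ⟨(eqvClass (kreweras s) e).max' hne, ?_, ?_⟩
      · intro f hf
        have := Finset.max'_mem _ hne
        rw [mem_eqvClass] at this
        exact Finset.le_max' _ _ (by simpa using (kreweras s).trans this hf)
      · rw [eqvClass_eq_iff]
        have := Finset.max'_mem _ hne
        rw [mem_eqvClass] at this
        exact (kreweras s).symm this
    · rintro ⟨e, _, rfl⟩
      exact ⟨e, rfl⟩
  rw [this, Finset.prod_image]
  intro e he f hf hef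
  simp only [Finset.coe_filter, Finset.mem_univ, true_and, Set.mem_ofPred_eq] at he hf
  have h := eqvClass_eq_iff.1 hef
  exact le_antisymm (hf _ ((kreweras s).symm h)) (he _ h)

/-! ### Cycles of the graph of a non-crossing partition -/

/-- The equivalence relation of a partition. -/
def blockSetoid {r : ℕ} (π : Part r) : Setoid (Fin r) := Setoid.ker π.part

theorem blockSetoid_iff {r : ℕ} {π : Part r} {x y : Fin r} :
    blockSetoid π x y ↔ π.part x = π.part y := Iff.rfl

theorem isCrossing_iff {r : ℕ} (π : Part r) : IsCrossing π ↔ Crossing (blockSetoid π) := by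
  constructor
  · rintro ⟨B, hB, C, hC, hBC, a₁, ha₁, a₂, ha₂, b₁, hb₁, b₂, hb₂, h1, h2, h3⟩
    have e1 := π.part_eq_of_mem hB ha₁
    have e2 := π.part_eq_of_mem hB ha₂
    have e3 := π.part_eq_of_mem hC hb₁
    have e4 := π.part_eq_of_mem hC hb₂
    refine ⟨a₁, b₁, a₂, b₂, h1, h2, h3, ?_, ?_, ?_⟩ <;> rw [blockSetoid_iff]
    · rw [e1, e2]
    · rw [e3, e4]
    · rwa [e1, e3]
  · rintro ⟨a, b, c, d, h1, h2, h3, h4, h5, h6⟩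
    rw [blockSetoid_iff] at h4 h5 h6
    have hm : ∀ x, x ∈ π.part x := fun x => π.mem_part (Finset.mem_univ x)
    exact ⟨π.part a, π.part_mem.2 (Finset.mem_univ _), π.part b, π.part_mem.2 (Finset.mem_univ _),
      h6, a, hm a, c, h4 ▸ hm c, b, hm b, d, h5 ▸ hm d, h1, h2, h3⟩

theorem val_add_one_eq {k : ℕ} (i : Fin (k + 1)) :
    ((i + 1 : Fin (k + 1)) : ℕ) = if (i : ℕ) = k then 0 else (i : ℕ) + 1 := by
  rw [Fin.val_add_one]
  simp [Fin.ext_iff]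

/-- In a non-crossing partition, each edge has a successor in its Kreweras class. -/
theorem exists_kreweras_succ {k : ℕ} {s : Setoid (Fin (k + 1))} (hs : ¬ Crossing s)
    (e : Fin (k + 1)) : ∃ f, s (e + 1) f ∧ kreweras s e f := by
  classical
  have hv := val_add_one_eq e
  have key : ∀ a b c d : Fin (k + 1), a < b → b < c → c < d → s a c → s b d → s a b := by
    intro a b c d h1 h2 h3 h4 h5
    by_contra h
    exact hs ⟨a, b, c, d, h1, h2, h3, h4, h5, h⟩
  -- The successor starts at the cyclic predecessor of `e + 1` in its block: the largest element of
  -- the block that is at most `e`, or, if there is none, the largest element of the block.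
  by_cases hC : ∃ x, s (e + 1) x ∧ x ≤ e
  · obtain ⟨f, hf, hmax⟩ := Finset.exists_max_image
      (Finset.univ.filter fun x => s (e + 1) x ∧ x ≤ e) id
      (by obtain ⟨x, hx⟩ := hC; exact ⟨x, by simpa using hx⟩)
    simp only [Finset.mem_filter, Finset.mem_univ, true_and, id] at hf hmax
    refine ⟨f, hf.1, ?_⟩
    -- The interval `(f, e]` misses the block of `e + 1`, so a block leaving it would cross that
    -- block.
    have main : ∀ x y, s x y → f < x → x ≤ e → f < y ∧ y ≤ e := by
      intro x y hxy hfx hxe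
      have hxC : ¬ s (e + 1) x := fun h => absurd (hmax x ⟨h, hxe⟩) (not_le.2 hfx)
      by_contra hy
      rw [not_and_or, not_lt, not_le] at hy
      have hyf : y ≠ f := by
        rintro rfl
        exact hxC (s.trans hf.1 (s.symm hxy))
      have hye : y ≠ e + 1 := by
        rintro rfl
        exact hxC (s.symm hxy)
      rcases hy with hy | hy
      · have hy' : y < f := lt_of_le_of_ne hy hyf
        by_cases he : (e : ℕ) = k
        · rw [if_pos he] at hv
          have h0 : e + 1 < y := by
            rw [Fin.lt_def, hv]
            rw [Ne, Fin.ext_iff, hv] at hye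
            omega
          exact hxC (s.trans (key (e + 1) y f x h0 hy' hfx hf.1 (s.symm hxy)) (s.symm hxy))
        · rw [if_neg he] at hv
          have h0 : x < e + 1 := by
            rw [Fin.lt_def, hv]; rw [Fin.le_def] at hxe; omega
          have := key y f x (e + 1) hy' hfx h0 (s.symm hxy) (s.symm hf.1)
          exact hxC (s.trans hf.1 (s.trans (s.symm this) (s.symm hxy)))
      · have he : ¬ (e : ℕ) = k := by
          intro h; rw [Fin.lt_def] at hy; omega
        rw [if_neg he] at hv
        have h0 : e + 1 < y := by
          rw [Fin.lt_def, hv]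
          rw [Ne, Fin.ext_iff, hv] at hye
          rw [Fin.lt_def] at hy
          omega
        have h1 : x < e + 1 := by
          rw [Fin.lt_def, hv]; rw [Fin.le_def] at hxe; omega
        have := key f x (e + 1) y hfx h1 h0 (s.symm hf.1) hxy
        exact hxC (s.trans hf.1 this)
    have hfe := hf.2
    rw [kreweras_iff]
    intro x y hxy
    have h1 := main x y hxy
    have h2 := main y x (s.symm hxy)
    have t1 : x ≤ f → x ≤ e := fun h => h.trans hfe
    have t2 : y ≤ f → y ≤ e := fun h => h.trans hfe
    simp only [← not_le] at h1 h2
    tauto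
  · push Not at hC
    have he : ¬ (e : ℕ) = k := by
      intro h
      rw [if_pos h] at hv
      have := hC (e + 1) (s.refl _)
      rw [Fin.lt_def] at this
      omega
    rw [if_neg he] at hv
    obtain ⟨f, hf, hmax⟩ := Finset.exists_max_image
      (Finset.univ.filter fun x => s (e + 1) x) id ⟨e + 1, by simp⟩
    simp only [Finset.mem_filter, Finset.mem_univ, true_and, id] at hf hmax
    refine ⟨f, hf, ?_⟩
    have hef := hC f hf
    -- Here `(e, f]` contains the whole block of `e + 1` and runs from its minimum to its maximum,
    -- so again no other block can leave it.
    have main : ∀ x y, s x y → e < x → x ≤ f → e < y ∧ y ≤ f := by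
      intro x y hxy hex hxf
      by_cases hxC : s (e + 1) x
      · have := s.trans hxC hxy
        exact ⟨hC y this, hmax y this⟩
      by_contra hy
      rw [not_and_or, not_lt, not_le] at hy
      have h1 : e + 1 < x := by
        have : x ≠ e + 1 := by rintro rfl; exact hxC (s.refl _)
        rw [Ne, Fin.ext_iff, hv] at this
        rw [Fin.lt_def] at hex ⊢
        omega
      have h2 : x < f := lt_of_le_of_ne hxf (by rintro rfl; exact hxC hf)
      rcases hy with hy | hy
      · have h0 : y < e + 1 := by
          rw [Fin.lt_def, hv]; rw [Fin.le_def] at hy; omega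
        have := key y (e + 1) x f h0 h1 h2 (s.symm hxy) hf
        exact hxC (s.trans (s.symm this) (s.symm hxy))
      · exact hxC (key (e + 1) x f y h1 h2 hy hf hxy)
    rw [kreweras_iff]
    intro x y hxy
    have h1 := main x y hxy
    have h2 := main y x (s.symm hxy)
    have t1 : x ≤ e → x ≤ f := fun h => h.trans hef.le
    have t2 : y ≤ e → y ≤ f := fun h => h.trans hef.le
    simp only [← not_le] at h1 h2
    tauto

/-- Kreweras-equivalent edges that start at the same block are equal. -/
theorem eq_of_kreweras_of_rel {r : ℕ} {s : Setoid (Fin r)} {e f : Fin r} (h : kreweras s e f)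
    (h' : s e f) : e = f := by
  have := h e f h'
  simp only [le_refl, iff_true, true_iff] at this
  rcases le_total e f with hef | hef
  · exact le_antisymm hef (this.1 hef)
  · exact le_antisymm (this.2 hef) hef

/-- For `e < f`, the element `e + 1` lies in `(e, f]`, while `f + 1` lies beyond it or wraps around
to `0`. -/
theorem eq_of_kreweras_of_rel_succ {k : ℕ} {s : Setoid (Fin (k + 1))} {e f : Fin (k + 1)}
    (h : kreweras s e f) (h' : s (e + 1) (f + 1)) : e = f := by
  wlog hlt : e < f generalizing e f
  · rcases eq_or_lt_of_le (not_lt.1 hlt) with h1 | h1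
    · exact h1.symm
    · exact (this ((kreweras s).symm h) (s.symm h') h1).symm
  exfalso
  have := h _ _ h'
  have he := val_add_one_eq e
  have hf := val_add_one_eq f
  simp only [Fin.le_def, Fin.lt_def] at this hlt
  have := f.isLt
  split_ifs at he hf <;> omega

open Fin.CommRing in
theorem forall_of_finRotate {t : ℕ} {P : Fin t → Prop} (h : ∀ k, P k → P (finRotate t k))
    {k : Fin t} (hk : P k) (l : Fin t) : P l := by
  obtain ⟨u, rfl⟩ : ∃ u, t = u + 1 := ⟨t - 1, by have := k.isLt; omega⟩
  have key : ∀ j : ℕ, P (k + (j : Fin (u + 1))) := by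
    intro j
    induction j with
    | zero => simpa using hk
    | succ j ih =>
      have := h _ ih
      rw [finRotate_apply] at this
      rwa [Nat.cast_succ, ← add_assoc]
  have := key (l - k).val
  rwa [Fin.cast_val_eq_self, add_sub_cancel] at this

/-- A cyclic step enters or leaves the interval between `e` and `g` only at its two ends. -/
theorem cut_succ_iff {k : ℕ} {e g h : Fin (k + 1)} (heg : e ≠ g) :
    (((h + 1 ≤ e ↔ h + 1 ≤ g) ↔ (h ≤ e ↔ h ≤ g)) ↔ (h ≠ e ∧ h ≠ g)) := by
  have hv := val_add_one_eq h
  have h1 := h.isLt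
  have h2 := e.isLt
  have h3 := g.isLt
  simp only [Ne, Fin.ext_iff, Fin.le_def, hv] at *
  split_ifs <;> omega

/-- A cycle is closed under Kreweras equivalence. -/
theorem IsCycle.mem_of_kreweras {k : ℕ} {π : Part (k + 1)} {E : Finset (Fin (k + 1))}
    (hE : IsCycle π E) {e g : Fin (k + 1)} (he : e ∈ E) (heg : kreweras (blockSetoid π) e g) :
    g ∈ E := by
  obtain ⟨t, c, -, hlink, -, rfl⟩ := hE
  by_contra hg
  have hne : e ≠ g := by rintro rfl; exact hg he
  simp only [Finset.mem_image, Finset.mem_univ, true_and, not_exists] at he hg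
  obtain ⟨j, hj⟩ := he
  have hblock : ∀ i, ((c i + 1 ≤ e ↔ c i + 1 ≤ g) ↔
      (c (finRotate t i) ≤ e ↔ c (finRotate t i) ≤ g)) := by
    intro i
    have h := hlink i
    rw [edgeTarget, edgeSource, finRotate_apply] at h
    exact heg _ _ h
  have hjump : ¬ ((e + 1 ≤ e ↔ e + 1 ≤ g) ↔ (e ≤ e ↔ e ≤ g)) := fun h =>
    ((cut_succ_iff hne).1 h).1 rfl
  -- Moves inside a block respect the cut by `e` and `g`, and edges cross it only at `e` and `g`. If
  -- `g` is missing, the walk after `e` stays on the side of `e + 1`, and yet it returns to `e`.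
  have := forall_of_finRotate
    (P := fun i => (c i ≤ e ↔ c i ≤ g) ↔ (e + 1 ≤ e ↔ e + 1 ≤ g))
    (k := finRotate t j) (by
      intro i hi
      by_cases hci : c i = e
      · rw [hci] at hi
        exact absurd hi.symm hjump
      · exact (hblock i).symm.trans (((cut_succ_iff hne).2 ⟨hci, hg i⟩).trans hi))
    (by have h1 := hblock j; rw [hj] at h1; exact h1.symm) j
  rw [hj] at this
  exact hjump this.symm

/-- All edges of a cycle of a non-crossing partition are Kreweras equivalent. -/
theorem IsCycle.kreweras {k : ℕ} {π : Part (k + 1)} (hπ : ¬ Crossing (blockSetoid π))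
    {E : Finset (Fin (k + 1))} (hE : IsCycle π E) {e g : Fin (k + 1)} (he : e ∈ E) (hg : g ∈ E) :
    kreweras (blockSetoid π) e g := by
  obtain ⟨t, c, ht, hlink, hinj, rfl⟩ := hE
  set s := blockSetoid π with hs
  have key : ∀ a b c d : Fin (k + 1), a < b → b < c → c < d → s a c → s b d → s a b := by
    intro a b c d h1 h2 h3 h4 h5
    by_contra h
    exact hπ ⟨a, b, c, d, h1, h2, h3, h4, h5, h⟩
  -- By non-crossing, a block other than that of `x` and `y` lies entirely between `x` and `y` or
  -- entirely outside.
  have inside : ∀ x y u v, x < y → s x y → s u v → ¬ s x u → x < u → u < y → x < v ∧ v < y := by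
    intro x y u v hxy sxy suv sxu hxu huy
    have hxv : ¬ s x v := fun h => sxu (s.trans h (s.symm suv))
    have hv1 : v ≠ x := by rintro rfl; exact hxv (s.refl _)
    have hv2 : v ≠ y := by rintro rfl; exact hxv sxy
    by_contra hv
    rw [not_and_or, not_lt, not_lt] at hv
    rcases hv with hv | hv
    · exact hxv (s.symm (key v x u y (lt_of_le_of_ne hv hv1) hxu huy (s.symm suv) sxy))
    · exact sxu (key x u y v hxu huy (lt_of_le_of_ne hv (Ne.symm hv2)) sxy suv)
  have hlink' : ∀ i, s (c i + 1) (c (finRotate t i)) := by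
    intro i
    have h := hlink i
    rwa [edgeTarget, edgeSource, finRotate_apply] at h
  have step : ∀ x y, x < y → s x y → ∀ i, ¬ s x (c (finRotate t i)) →
      ((x ≤ c i ∧ c i < y) ↔ (x ≤ c (finRotate t i) ∧ c (finRotate t i) < y)) := by
    intro x y hxy sxy i hi
    have hl := hlink' i
    have hi' : ¬ s x (c i + 1) := fun h => hi (s.trans h hl)
    have h1 := inside x y _ _ hxy sxy hl hi'
    have h2 := inside x y _ _ hxy sxy (s.symm hl) hi
    have h3 : x ≠ c i + 1 := by intro h; exact hi' (h ▸ s.refl _)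
    have h4 : y ≠ c i + 1 := by intro h; exact hi' (h ▸ sxy)
    have h5 : x ≠ c (finRotate t i) := by intro h; exact hi (h ▸ s.refl _)
    have hv := val_add_one_eq (c i)
    have hy := y.isLt
    simp only [Ne, Fin.ext_iff, Fin.le_def, Fin.lt_def, hv] at *
    split_ifs at * <;> omega
  have const : ∀ x y, x < y → s x y → ∀ i j,
      ((x ≤ c i ∧ c i < y) ↔ (x ≤ c j ∧ c j < y)) := by
    intro x y hxy sxy
    -- The cycle visits the block of `x` at most once, so `step` applies to every transition except
    -- possibly the one into `j`. Starting at `j`, the remaining transitions reach the whole cycle.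
    obtain ⟨j, hj⟩ : ∃ j, ∀ i, finRotate t i ≠ j → ¬ s x (c (finRotate t i)) := by
      by_cases h : ∃ j, s x (c j)
      · obtain ⟨j, hj⟩ := h
        refine ⟨j, fun i hi h => hi (hinj ?_)⟩
        exact s.trans (s.symm h) hj
      · push Not at h
        exact ⟨⟨0, ht⟩, fun i _ => h _⟩
    have all := forall_of_finRotate
      (P := fun i => (x ≤ c i ∧ c i < y) ↔ (x ≤ c j ∧ c j < y)) (k := j) (by
        intro i hi
        by_cases h : finRotate t i = j
        · rw [h]
        · exact (step x y hxy sxy i (hj i h)).symm.trans hi) Iff.rfl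
    exact fun i i' => (all i).trans (all i').symm
  simp only [Finset.mem_image, Finset.mem_univ, true_and] at he hg
  obtain ⟨i, rfl⟩ := he
  obtain ⟨j, rfl⟩ := hg
  intro x y hxy
  rcases lt_trichotomy x y with h | rfl | h
  · have := const x y h hxy i j
    simp only [Fin.le_def, Fin.lt_def] at *
    omega
  · rfl
  · have := const y x h (s.symm hxy) i j
    simp only [Fin.le_def, Fin.lt_def] at *
    omega

/-- Each Kreweras class of a non-crossing partition contains a cycle through each of its edges. -/
theorem exists_isCycle {k : ℕ} {π : Part (k + 1)} (hπ : ¬ Crossing (blockSetoid π))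
    (e : Fin (k + 1)) : ∃ E, IsCycle π E ∧ e ∈ E := by
  -- The successor map is injective on a finite set, so the orbit of `e` closes up. It repeats no
  -- vertex because equivalent edges with a common source coincide.
  choose σ hσ hσ' using exists_kreweras_succ hπ
  have hinj : Function.Injective σ := by
    intro a b hab
    refine eq_of_kreweras_of_rel_succ (s := blockSetoid π) ?_ ?_
    · exact (kreweras _).trans (hσ' a) (hab ▸ (kreweras _).symm (hσ' b))
    · exact (blockSetoid π).trans (hσ a) (hab ▸ (blockSetoid π).symm (hσ b))
  have hiter : ∀ j : ℕ, kreweras (blockSetoid π) e (σ^[j] e) := by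
    intro j
    induction j with
    | zero => exact (kreweras _).refl _
    | succ j ih =>
      rw [Function.iterate_succ_apply']
      exact (kreweras _).trans ih (hσ' _)
  have hpos : 0 < Function.minimalPeriod σ e :=
    Function.minimalPeriod_pos_of_mem_periodicPts (hinj.mem_periodicPts e)
  refine ⟨_, ⟨Function.minimalPeriod σ e, fun j => σ^[j] e, hpos, ?_, ?_, rfl⟩, ?_⟩
  · intro j
    have h : σ^[(finRotate _ j : Fin _)] e = σ (σ^[j] e) := by
      have hj := j.isLt
      by_cases hl : (j : ℕ) + 1 < Function.minimalPeriod σ e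
      · have : ((finRotate _ j : Fin _) : ℕ) = j + 1 := by
          generalize Function.minimalPeriod σ e = t at *
          obtain ⟨u, rfl⟩ : ∃ u, t = u + 1 := ⟨t - 1, by omega⟩
          rw [finRotate_apply, val_add_one_eq, if_neg (by omega)]
        rw [this, Function.iterate_succ_apply']
      · have h1 : ((finRotate _ j : Fin _) : ℕ) = 0 := by
          generalize Function.minimalPeriod σ e = t at *
          obtain ⟨u, rfl⟩ : ∃ u, t = u + 1 := ⟨t - 1, by omega⟩
          rw [finRotate_apply, val_add_one_eq, if_pos (by omega)]
        have h2 : (j : ℕ) + 1 = Function.minimalPeriod σ e := by omega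
        rw [h1, ← Function.iterate_succ_apply' σ, Nat.succ_eq_add_one, h2,
          Function.iterate_minimalPeriod]
        rfl
    have h' := hσ (σ^[j] e)
    rw [← h] at h'
    rwa [edgeTarget, edgeSource, finRotate_apply]
  · intro i j hij
    have h := eq_of_kreweras_of_rel
      ((kreweras (blockSetoid π)).trans ((kreweras _).symm (hiter i)) (hiter j)) hij
    exact Fin.ext (Function.iterate_injOn_Iio_minimalPeriod i.isLt j.isLt h)
  · simp only [Finset.mem_image, Finset.mem_univ, true_and]
    exact ⟨⟨0, hpos⟩, rfl⟩

/-- The cycles of a non-crossing partition are the classes of its Kreweras complement. -/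
theorem isCycle_iff {k : ℕ} {π : Part (k + 1)} (hπ : ¬ Crossing (blockSetoid π))
    (E : Finset (Fin (k + 1))) :
    IsCycle π E ↔ ∃ e, eqvClass (kreweras (blockSetoid π)) e = E := by
  have key : ∀ E, IsCycle π E → ∀ e ∈ E, eqvClass (kreweras (blockSetoid π)) e = E := by
    intro E hE e he
    ext g
    rw [mem_eqvClass]
    exact ⟨fun h => hE.mem_of_kreweras he h, fun h => hE.kreweras hπ he h⟩
  constructor
  · intro hE
    obtain ⟨t, c, ht, -, -, hEc⟩ := id hE
    exact ⟨c ⟨0, ht⟩, key E hE _ (hEc ▸ Finset.mem_image_of_mem c (Finset.mem_univ _))⟩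
  · rintro ⟨e, rfl⟩
    obtain ⟨E, hE, he⟩ := exists_isCycle hπ e
    rwa [key E hE e he]

theorem value_eq_setoidValue {k : ℕ} (π : Part (k + 1)) (γ : ℝ) :
    value π γ = setoidValue γ (blockSetoid π) := by
  classical
  rw [value, setoidValue]
  by_cases h : IsCrossing π
  · rw [if_pos h, if_pos ((isCrossing_iff π).1 h)]
  · have h' : ¬ Crossing (blockSetoid π) := fun h' => h ((isCrossing_iff π).2 h')
    rw [if_neg h, if_neg h', weight]
    refine Finset.prod_congr ?_ fun _ _ => rfl
    ext E
    simp [cycles, isCycle_iff h']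

/-! ### Rotation -/

/-- The rotation of a setoid by one step. -/
def rotate {k : ℕ} (s : Setoid (Fin (k + 1))) : Setoid (Fin (k + 1)) := s.comap (· + 1)

theorem rotate_iff {k : ℕ} {s : Setoid (Fin (k + 1))} {x y : Fin (k + 1)} :
    rotate s x y ↔ s (x + 1) (y + 1) := Iff.rfl

/-- Crossing is a cyclic condition: a point that wraps around moves to the other end of the pattern,
and the two pairs exchange roles. -/
theorem crossing_rotate {k : ℕ} {s : Setoid (Fin (k + 1))} : Crossing (rotate s) ↔ Crossing s := by
  constructor
  · rintro ⟨a, b, c, d, h1, h2, h3, h4, h5, h6⟩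
    rw [rotate_iff] at h4 h5 h6
    have va := val_add_one_eq a
    have vb := val_add_one_eq b
    have vc := val_add_one_eq c
    have vd := val_add_one_eq d
    have := d.isLt
    simp only [Fin.lt_def] at h1 h2 h3
    by_cases hd : (d : ℕ) = k
    · refine ⟨d + 1, a + 1, b + 1, c + 1, ?_, ?_, ?_, s.symm h5, h4, fun h => h6 ?_⟩
      iterate 3 rw [Fin.lt_def]; split_ifs at * <;> omega
      exact s.trans (s.symm h) (s.symm h5)
    · refine ⟨a + 1, b + 1, c + 1, d + 1, ?_, ?_, ?_, h4, h5, h6⟩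
      iterate 3 rw [Fin.lt_def]; split_ifs at * <;> omega
  · rintro ⟨a, b, c, d, h1, h2, h3, h4, h5, h6⟩
    obtain ⟨a, rfl⟩ : ∃ x, x + 1 = a := ⟨a - 1, sub_add_cancel a 1⟩
    obtain ⟨b, rfl⟩ : ∃ x, x + 1 = b := ⟨b - 1, sub_add_cancel b 1⟩
    obtain ⟨c, rfl⟩ : ∃ x, x + 1 = c := ⟨c - 1, sub_add_cancel c 1⟩
    obtain ⟨d, rfl⟩ : ∃ x, x + 1 = d := ⟨d - 1, sub_add_cancel d 1⟩
    have va := val_add_one_eq a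
    have vb := val_add_one_eq b
    have vc := val_add_one_eq c
    have vd := val_add_one_eq d
    have := d.isLt
    have := c.isLt
    have := b.isLt
    have := a.isLt
    simp only [Fin.lt_def] at h1 h2 h3
    by_cases ha : (a : ℕ) = k
    · refine ⟨b, c, d, a, ?_, ?_, ?_, h5, s.symm h4, fun h => h6 ?_⟩
      iterate 3 rw [Fin.lt_def]; split_ifs at * <;> omega
      exact s.trans h4 (s.symm h)
    · refine ⟨a, b, c, d, ?_, ?_, ?_, h4, h5, h6⟩
      iterate 3 rw [Fin.lt_def]; split_ifs at * <;> omega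

theorem add_one_le_add_one_iff {k : ℕ} {x e : Fin (k + 1)} :
    x + 1 ≤ e + 1 ↔ ((x ≤ e) ↔ (x = Fin.last k ↔ e = Fin.last k)) := by
  have vx := val_add_one_eq x
  have ve := val_add_one_eq e
  have := x.isLt
  have := e.isLt
  simp only [Fin.le_def, Fin.ext_iff, Fin.val_last]
  split_ifs at * <;> omega

/-- The shift toggles a comparison exactly when one of the two elements is last and the other is
not. These toggles cancel in the nested equivalences. -/
theorem kreweras_rotate {k : ℕ} {s : Setoid (Fin (k + 1))} {e f : Fin (k + 1)} :
    kreweras (rotate s) e f ↔ kreweras s (e + 1) (f + 1) := by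
  have key : ∀ x y : Fin (k + 1), ((x + 1 ≤ e + 1 ↔ x + 1 ≤ f + 1) ↔
      (y + 1 ≤ e + 1 ↔ y + 1 ≤ f + 1)) ↔ ((x ≤ e ↔ x ≤ f) ↔ (y ≤ e ↔ y ≤ f)) := by
    intro x y
    simp only [add_one_le_add_one_iff]
    have h1 : ∀ a b p q u : Prop, ((a ↔ (u ↔ p)) ↔ (b ↔ (u ↔ q))) ↔ ((a ↔ b) ↔ (p ↔ q)) := by
      intro a b p q u
      by_cases u <;> by_cases p <;> by_cases q <;> simp [*, not_iff_not, iff_comm, not_iff] <;> tauto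
    have h2 : ∀ a b z : Prop, ((a ↔ z) ↔ (b ↔ z)) ↔ (a ↔ b) := by
      intro a b z
      by_cases z <;> simp [*, not_iff_not]
    rw [h1, h1, h2]
  constructor
  · intro h x y hxy
    obtain ⟨x, rfl⟩ : ∃ z, z + 1 = x := ⟨x - 1, sub_add_cancel x 1⟩
    obtain ⟨y, rfl⟩ : ∃ z, z + 1 = y := ⟨y - 1, sub_add_cancel y 1⟩
    exact (key x y).2 (h x y hxy)
  · intro h x y hxy
    exact (key x y).1 (h _ _ hxy)

theorem setoidValue_rotate (γ : ℝ) {k : ℕ} (s : Setoid (Fin (k + 1))) :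
    setoidValue γ (rotate s) = setoidValue γ s := by
  classical
  have hinj : Function.Injective fun E : Finset (Fin (k + 1)) => E.image (· + 1) :=
    Finset.image_injective (add_left_injective 1)
  have himg : ∀ e, (eqvClass (kreweras (rotate s)) e).image (· + 1) =
      eqvClass (kreweras s) (e + 1) := by
    intro e
    ext f
    simp only [Finset.mem_image, mem_eqvClass, kreweras_rotate]
    constructor
    · rintro ⟨g, hg, rfl⟩
      exact hg
    · intro h
      exact ⟨f - 1, by rwa [sub_add_cancel], sub_add_cancel f 1⟩
  have : Finset.univ.image (eqvClass (kreweras s)) =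
      (Finset.univ.image (eqvClass (kreweras (rotate s)))).image (fun E => E.image (· + 1)) := by
    rw [Finset.image_image]
    ext E
    simp only [Finset.mem_image, Finset.mem_univ, true_and, Function.comp_apply, himg]
    constructor
    · rintro ⟨e, rfl⟩
      exact ⟨e - 1, by rw [sub_add_cancel]⟩
    · rintro ⟨e, rfl⟩
      exact ⟨e + 1, rfl⟩
  rw [setoidValue, setoidValue, crossing_rotate, weight, weight, this,
    Finset.prod_image hinj.injOn]
  simp_rw [Finset.card_image_of_injective _ (add_left_injective (1 : Fin (k + 1)))]

/-! ### Restriction to an initial segment and one-element extensions -/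

/-- The restriction of a setoid to all elements but the last. -/
def restrict {k : ℕ} (s : Setoid (Fin (k + 1))) : Setoid (Fin k) := s.comap Fin.castSucc

theorem restrict_iff {k : ℕ} {s : Setoid (Fin (k + 1))} {x y : Fin k} :
    restrict s x y ↔ s x.castSucc y.castSucc := Iff.rfl

theorem Crossing.of_restrict {k : ℕ} {s : Setoid (Fin (k + 1))} (h : Crossing (restrict s)) :
    Crossing s := by
  obtain ⟨a, b, c, d, h1, h2, h3, h4, h5, h6⟩ := h
  exact ⟨a.castSucc, b.castSucc, c.castSucc, d.castSucc, h1, h2, h3, h4, h5, h6⟩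

/-- In a crossing that uses the last element, `0` can replace it: the point moves from the end of
the pattern to its start. -/
theorem crossing_restrict_of_last_zero {k : ℕ} {s : Setoid (Fin (k + 1))}
    (h0 : s (Fin.last k) 0) : Crossing (restrict s) ↔ Crossing s := by
  refine ⟨Crossing.of_restrict, ?_⟩
  rintro ⟨a, b, c, d, h1, h2, h3, h4, h5, h6⟩
  have ha : a < Fin.last k := (h1.trans (h2.trans h3)).trans_le (Fin.le_last _)
  have hb : b < Fin.last k := (h2.trans h3).trans_le (Fin.le_last _)
  have hc : c < Fin.last k := h3.trans_le (Fin.le_last _)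
  obtain ⟨a, rfl⟩ := Fin.exists_castSucc_eq.2 ha.ne
  obtain ⟨b, rfl⟩ := Fin.exists_castSucc_eq.2 hb.ne
  obtain ⟨c, rfl⟩ := Fin.exists_castSucc_eq.2 hc.ne
  by_cases hd : d = Fin.last k
  · subst hd
    have hb0 : s b.castSucc 0 := s.trans h5 h0
    obtain ⟨l, rfl⟩ : ∃ l, k = l + 1 := ⟨k - 1, by have := a.isLt; omega⟩
    have ha0 : a ≠ 0 := by
      rintro rfl
      exact h6 (s.symm hb0)
    refine ⟨0, a, b, c, Fin.pos_of_ne_zero ha0, h1, h2, ?_, h4, fun h => h6 ?_⟩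
    · exact s.symm hb0
    · exact s.trans (s.symm h) (s.symm hb0)
  · obtain ⟨d, rfl⟩ := Fin.exists_castSucc_eq.2 hd
    exact ⟨a, b, c, d, h1, h2, h3, h4, h5, h6⟩

/-! ### The outer Kreweras class and the contributions of single edges -/

theorem kreweras_last_iff {k : ℕ} {s : Setoid (Fin (k + 1))} {e : Fin (k + 1)} :
    kreweras s (Fin.last k) e ↔ ∀ x y, s x y → (x ≤ e ↔ y ≤ e) := by
  simp [kreweras_iff, Fin.le_last]

/-- The value contributed by the edge `e` if it is the last edge of its Kreweras class. -/
noncomputable def edgeValue (γ : ℝ) {r : ℕ} (s : Setoid (Fin r)) (e : Fin r) : ℝ :=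
  open Classical in
  if ∀ f, kreweras s e f → f ≤ e then A γ (eqvClass (kreweras s) e).card else 1

theorem weight_eq_prod_edgeValue (γ : ℝ) {r : ℕ} (s : Setoid (Fin r)) :
    weight γ s = ∏ e, edgeValue γ s e := weight_eq_prod γ s

theorem edgeValue_last (γ : ℝ) {k : ℕ} (s : Setoid (Fin (k + 1))) :
    edgeValue γ s (Fin.last k) = A γ (eqvClass (kreweras s) (Fin.last k)).card := by
  rw [edgeValue, if_pos fun f _ => Fin.le_last f]

theorem edgeValue_of_lt (γ : ℝ) {r : ℕ} {s : Setoid (Fin r)} {e f : Fin r}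
    (h : kreweras s e f) (hef : e < f) : edgeValue γ s e = 1 := by
  rw [edgeValue, if_neg fun h' => absurd (h' f h) (not_le.2 hef)]

theorem edgeValue_congr (γ : ℝ) {k : ℕ} {s : Setoid (Fin k)} {t : Setoid (Fin (k + 1))} {e : Fin k}
    (h : ∀ f, kreweras t e.castSucc f.castSucc ↔ kreweras s e f)
    (h' : ¬ kreweras t e.castSucc (Fin.last k)) : edgeValue γ t e.castSucc = edgeValue γ s e := by
  classical
  have hc : eqvClass (kreweras t) e.castSucc =
      (eqvClass (kreweras s) e).map Fin.castSuccEmb := by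
    ext f
    refine Fin.lastCases ?_ (fun f => ?_) f
    · simp [h', (Fin.castSucc_lt_last _).ne]
    · simp [h]
  have hm : (∀ f, kreweras t e.castSucc f → f ≤ e.castSucc) ↔ ∀ f, kreweras s e f → f ≤ e := by
    constructor
    · intro hf f hef
      exact hf f.castSucc ((h f).2 hef)
    · intro hf f
      refine Fin.lastCases (fun hl => absurd hl h') (fun f hef => ?_) f
      exact hf f ((h f).1 hef)
  rw [edgeValue, edgeValue, hc, Finset.card_map]
  exact if_congr hm rfl rfl

/-- If `e` is equivalent to the last edge, the initial segment up to `e` is a union of blocks. It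
contains `0`, hence also the last element. -/
theorem eqvClass_kreweras_last_of_last_zero {k : ℕ} {s : Setoid (Fin (k + 1))}
    (h0 : s (Fin.last k) 0) : eqvClass (kreweras s) (Fin.last k) = {Fin.last k} := by
  ext e
  rw [mem_eqvClass, Finset.mem_singleton]
  constructor
  · intro h
    have := (kreweras_last_iff.1 h _ _ h0).2 (Fin.zero_le e)
    exact le_antisymm (Fin.le_last e) this
  · rintro rfl
    exact (kreweras s).refl _

theorem edgeValue_restrict_of_last_zero (γ : ℝ) {k : ℕ} {s : Setoid (Fin (k + 1))}
    (h0 : s (Fin.last k) 0) (e : Fin k) :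
    edgeValue γ s e.castSucc = edgeValue γ (restrict s) e := by
  have hl := eqvClass_kreweras_last_of_last_zero h0
  apply edgeValue_congr
  · intro f
    constructor
    · intro h x y hxy
      exact h _ _ hxy
    · intro h
      -- The last element lies after both `e` and `f`, and its partner `0` lies before or at both.
      -- Neither is in the interval, so the condition at `0` covers the last element.
      have main : ∀ x : Fin k, ∀ y, s x.castSucc y →
          ((x.castSucc ≤ e.castSucc ↔ x.castSucc ≤ f.castSucc) ↔
            (y ≤ e.castSucc ↔ y ≤ f.castSucc)) := by
        intro x y
        refine Fin.lastCases (fun hxy => ?_) (fun y hxy => h x y hxy) y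
        have he : ¬ Fin.last k ≤ e.castSucc := not_le.2 (Fin.castSucc_lt_last e)
        have hf : ¬ Fin.last k ≤ f.castSucc := not_le.2 (Fin.castSucc_lt_last f)
        obtain ⟨l, rfl⟩ : ∃ l, k = l + 1 := ⟨k - 1, by have := e.isLt; omega⟩
        have h1 := h x 0 (s.trans hxy h0)
        have h2 : (0 : Fin (l + 1)) ≤ e := Fin.zero_le e
        have h3 : (0 : Fin (l + 1)) ≤ f := Fin.zero_le f
        simp only [Fin.castSucc_le_castSucc_iff, he, hf]
        simp only [h2, h3] at h1
        tauto
      intro x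
      refine Fin.lastCases (fun y => ?_) (fun x y hxy => main x y hxy) x
      refine Fin.lastCases (fun _ => Iff.rfl) (fun y hxy => ?_) y
      exact (main y _ (s.symm hxy)).symm
  · intro h
    have : e.castSucc ∈ eqvClass (kreweras s) (Fin.last k) := mem_eqvClass.2 ((kreweras s).symm h)
    rw [hl, Finset.mem_singleton] at this
    exact (Fin.castSucc_lt_last e).ne this

/-- The last edge is a loop and a class by itself, which gives the factor `A γ 1`; removing it
leaves the other classes unchanged. -/
theorem setoidValue_of_last_zero (γ : ℝ) {k : ℕ} {s : Setoid (Fin (k + 1))}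
    (h0 : s (Fin.last k) 0) : setoidValue γ s = A γ 1 * setoidValue γ (restrict s) := by
  rw [setoidValue, setoidValue, crossing_restrict_of_last_zero h0, mul_ite, mul_zero]
  congr 1
  rw [weight_eq_prod_edgeValue, weight_eq_prod_edgeValue, Fin.prod_univ_castSucc, edgeValue_last,
    eqvClass_kreweras_last_of_last_zero h0, Finset.card_singleton, mul_comm]
  simp_rw [edgeValue_restrict_of_last_zero γ h0]

/-- The extension of a setoid by a new last element, which is put into the block of `e` for
`o = some e`, and into a block of its own for `o = none`. -/
def extend {k : ℕ} (s : Setoid (Fin k)) (o : Option (Fin k)) : Setoid (Fin (k + 1)) :=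
  Setoid.ker (Fin.lastCases (motive := fun _ => Option (Quotient s)) (o.map (Quotient.mk s))
    fun x => some (Quotient.mk s x))

theorem extend_castSucc {k : ℕ} {s : Setoid (Fin k)} {o : Option (Fin k)} {x y : Fin k} :
    extend s o x.castSucc y.castSucc ↔ s x y := by
  rw [extend, Setoid.ker_def, Fin.lastCases_castSucc, Fin.lastCases_castSucc, Option.some_inj,
    Quotient.eq]

theorem extend_none_last {k : ℕ} {s : Setoid (Fin k)} {x : Fin k} :
    ¬ extend s none (Fin.last k) x.castSucc := by
  rw [extend, Setoid.ker_def, Fin.lastCases_castSucc, Fin.lastCases_last]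
  simp

theorem extend_some_last {k : ℕ} {s : Setoid (Fin k)} {e x : Fin k} :
    extend s (some e) (Fin.last k) x.castSucc ↔ s e x := by
  rw [extend, Setoid.ker_def, Fin.lastCases_castSucc, Fin.lastCases_last, Option.map_some,
    Option.some_inj, Quotient.eq]

theorem restrict_extend {k : ℕ} (s : Setoid (Fin k)) (o : Option (Fin k)) :
    restrict (extend s o) = s := by
  ext x y
  exact extend_castSucc

theorem setoid_ext_last {k : ℕ} {s t : Setoid (Fin (k + 1))} (h : restrict s = restrict t)
    (h' : ∀ x : Fin k, s (Fin.last k) x.castSucc ↔ t (Fin.last k) x.castSucc) : s = t := by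
  have h1 : ∀ x y : Fin k, s x.castSucc y.castSucc ↔ t x.castSucc y.castSucc := by
    intro x y
    rw [← restrict_iff, h, restrict_iff]
  ext x y
  refine Fin.lastCases ?_ (fun x => ?_) x <;> refine Fin.lastCases ?_ (fun y => ?_) y
  · exact ⟨fun _ => t.refl _, fun _ => s.refl _⟩
  · exact h' y
  · exact ⟨fun h => t.symm ((h' x).1 (s.symm h)), fun h => s.symm ((h' x).2 (t.symm h))⟩
  · exact h1 x y

theorem eq_extend_none {k : ℕ} {t : Setoid (Fin (k + 1))}
    (h : ∀ x : Fin k, ¬ t (Fin.last k) x.castSucc) : t = extend (restrict t) none :=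
  setoid_ext_last (restrict_extend _ _).symm fun x =>
    ⟨fun h' => absurd h' (h x), fun h' => absurd h' extend_none_last⟩

theorem eq_extend_some {k : ℕ} {t : Setoid (Fin (k + 1))} {e : Fin k}
    (h : t (Fin.last k) e.castSucc) : t = extend (restrict t) (some e) :=
  setoid_ext_last (restrict_extend _ _).symm fun x => by
    rw [extend_some_last, restrict_iff]
    exact ⟨fun h' => t.trans (t.symm h) h', fun h' => t.trans h h'⟩

/-! ### Which one-element extensions are non-crossing -/

theorem not_crossing_extend_none {k : ℕ} {s : Setoid (Fin k)} (hs : ¬ Crossing s) :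
    ¬ Crossing (extend s none) := by
  rintro ⟨a, b, c, d, h1, h2, h3, h4, h5, h6⟩
  have ha : a < Fin.last k := (h1.trans (h2.trans h3)).trans_le (Fin.le_last _)
  have hb : b < Fin.last k := (h2.trans h3).trans_le (Fin.le_last _)
  have hc : c < Fin.last k := h3.trans_le (Fin.le_last _)
  obtain ⟨a, rfl⟩ := Fin.exists_castSucc_eq.2 ha.ne
  obtain ⟨b, rfl⟩ := Fin.exists_castSucc_eq.2 hb.ne
  obtain ⟨c, rfl⟩ := Fin.exists_castSucc_eq.2 hc.ne
  have hd : d ≠ Fin.last k := by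
    rintro rfl
    exact extend_none_last ((extend s none).symm h5)
  obtain ⟨d, rfl⟩ := Fin.exists_castSucc_eq.2 hd
  rw [extend_castSucc] at h4 h5 h6
  exact hs ⟨a, b, c, d, h1, h2, h3, h4, h5, h6⟩

/-- No block straddles the end of the initial segment up to `e`. A crossing through the new element
would therefore give one with `e` in its place. -/
theorem not_crossing_extend_some {k : ℕ} {s : Setoid (Fin (k + 1))} (hs : ¬ Crossing s)
    {e : Fin (k + 1)} (he : kreweras s (Fin.last k) e) : ¬ Crossing (extend s (some e)) := by
  rintro ⟨a, b, c, d, h1, h2, h3, h4, h5, h6⟩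
  have ha : a < Fin.last (k + 1) := (h1.trans (h2.trans h3)).trans_le (Fin.le_last _)
  have hb : b < Fin.last (k + 1) := (h2.trans h3).trans_le (Fin.le_last _)
  have hc : c < Fin.last (k + 1) := h3.trans_le (Fin.le_last _)
  obtain ⟨a, rfl⟩ := Fin.exists_castSucc_eq.2 ha.ne
  obtain ⟨b, rfl⟩ := Fin.exists_castSucc_eq.2 hb.ne
  obtain ⟨c, rfl⟩ := Fin.exists_castSucc_eq.2 hc.ne
  rw [extend_castSucc] at h4 h6
  by_cases hd : d = Fin.last (k + 1)
  · subst hd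
    have heb : s e b := extend_some_last.1 ((extend s (some e)).symm h5)
    have hbe : b ≤ e := (kreweras_last_iff.1 he _ _ heb).1 le_rfl
    have hce : c ≤ e := (kreweras_last_iff.1 he _ _ h4).1 (le_trans (le_of_lt (Fin.castSucc_lt_castSucc_iff.1 h1)) hbe)
    have hne : c ≠ e := by
      rintro rfl
      exact h6 (s.trans h4 heb)
    exact hs ⟨a, b, c, e, h1, h2, lt_of_le_of_ne hce hne, h4, s.symm heb, h6⟩
  · obtain ⟨d, rfl⟩ := Fin.exists_castSucc_eq.2 hd
    rw [extend_castSucc] at h5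
    exact hs ⟨a, b, c, d, h1, h2, h3, h4, h5, h6⟩

/-- A non-crossing extension puts the new element into its own block, or into an outer block. -/
theorem eq_extend_of_not_crossing {k : ℕ} {t : Setoid (Fin (k + 2))} (ht : ¬ Crossing t) :
    t = extend (restrict t) none ∨
      ∃ e, kreweras (restrict t) (Fin.last k) e ∧ t = extend (restrict t) (some e) := by
  classical
  by_cases h : ∀ x : Fin (k + 1), ¬ t (Fin.last _) x.castSucc
  · exact Or.inl (eq_extend_none h)
  · right
    push Not at h
    obtain ⟨e, he, hmax⟩ := Finset.exists_max_image
      (Finset.univ.filter fun x : Fin (k + 1) => t (Fin.last _) x.castSucc) id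
      (by obtain ⟨x, hx⟩ := h; exact ⟨x, by simpa using hx⟩)
    simp only [Finset.mem_filter, Finset.mem_univ, true_and, id] at he hmax
    refine ⟨e, ?_, eq_extend_some he⟩
    -- With `e` the largest old element in the block of the new one, a block straddling `e` would
    -- cross that block: `x < e < y < last`.
    have main : ∀ x y, restrict t x y → x ≤ e → y ≤ e := by
      intro x y hxy hxe
      by_contra hy
      rw [not_le] at hy
      have hx : ¬ t (Fin.last _) x.castSucc := fun h' =>
        absurd (hmax y (t.trans h' hxy)) (not_le.2 hy)
      have hne : x ≠ e := by
        rintro rfl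
        exact hx he
      refine ht ⟨x.castSucc, e.castSucc, y.castSucc, Fin.last _,
        Fin.castSucc_lt_castSucc_iff.2 (lt_of_le_of_ne hxe hne), hy,
        Fin.castSucc_lt_last y, hxy, t.symm he, fun h' => hx (t.trans he (t.symm h'))⟩
    rw [kreweras_last_iff]
    exact fun x y hxy => ⟨main x y hxy, main y x ((restrict t).symm hxy)⟩

/-! ### The Kreweras complement of an extension -/

theorem kreweras_extend_none {k : ℕ} {s : Setoid (Fin k)} {e f : Fin k} :
    kreweras (extend s none) e.castSucc f.castSucc ↔ kreweras s e f := by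
  constructor
  · intro h x y hxy
    exact h _ _ (extend_castSucc.2 hxy)
  · intro h x y
    refine Fin.lastCases ?_ (fun x => ?_) x <;> refine Fin.lastCases ?_ (fun y => ?_) y
    · exact fun _ => Iff.rfl
    · exact fun h' => absurd h' extend_none_last
    · exact fun h' => absurd ((extend s none).symm h') extend_none_last
    · exact fun h' => h _ _ (extend_castSucc.1 h')

theorem kreweras_extend_none_last {k : ℕ} {s : Setoid (Fin (k + 1))} {e : Fin (k + 1)} :
    kreweras (extend s none) (Fin.last (k + 1)) e.castSucc ↔ kreweras s (Fin.last k) e := by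
  rw [kreweras_last_iff, kreweras_last_iff]
  constructor
  · intro h x y hxy
    exact h _ _ (extend_castSucc.2 hxy)
  · intro h x y
    refine Fin.lastCases ?_ (fun x => ?_) x <;> refine Fin.lastCases ?_ (fun y => ?_) y
    · exact fun _ => Iff.rfl
    · exact fun h' => absurd h' extend_none_last
    · exact fun h' => absurd ((extend s none).symm h') extend_none_last
    · exact fun h' => h _ _ (extend_castSucc.1 h')

/-- The new element lies after both edges, hence outside the interval between them, so its partner
`a` must lie outside as well. -/
theorem kreweras_extend_some {k : ℕ} {s : Setoid (Fin k)} {a e f : Fin k} :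
    kreweras (extend s (some a)) e.castSucc f.castSucc ↔
      kreweras s e f ∧ (a ≤ e ↔ a ≤ f) := by
  have he : ¬ Fin.last k ≤ e.castSucc := not_le.2 (Fin.castSucc_lt_last e)
  have hf : ¬ Fin.last k ≤ f.castSucc := not_le.2 (Fin.castSucc_lt_last f)
  constructor
  · intro h
    refine ⟨fun x y hxy => h _ _ (extend_castSucc.2 hxy), ?_⟩
    have := h _ _ (extend_some_last.2 (s.refl a))
    simp only [he, hf] at this
    simpa using this
  · rintro ⟨h, ha⟩
    have main : ∀ y, s a y → (y ≤ e ↔ y ≤ f) := fun y hy => (h a y hy).1 ha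
    intro x y
    refine Fin.lastCases ?_ (fun x => ?_) x <;> refine Fin.lastCases ?_ (fun y => ?_) y
    · exact fun _ => Iff.rfl
    · intro h'
      simp only [he, hf, Fin.castSucc_le_castSucc_iff, main y (extend_some_last.1 h')]
    · intro h'
      simp only [he, hf, Fin.castSucc_le_castSucc_iff,
        main x (extend_some_last.1 ((extend s (some a)).symm h'))]
    · exact fun h' => h _ _ (extend_castSucc.1 h')

/-- The interval from `e` to the new last edge contains the new element, so it must contain `a`.
Thus the outer class is cut at `a`. -/
theorem kreweras_extend_some_last {k : ℕ} {s : Setoid (Fin (k + 1))} {a e : Fin (k + 1)} :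
    kreweras (extend s (some a)) (Fin.last (k + 1)) e.castSucc ↔
      kreweras s (Fin.last k) e ∧ e < a := by
  have he : ¬ Fin.last (k + 1) ≤ e.castSucc := not_le.2 (Fin.castSucc_lt_last e)
  rw [kreweras_last_iff, kreweras_last_iff]
  constructor
  · intro h
    refine ⟨fun x y hxy => h _ _ (extend_castSucc.2 hxy), ?_⟩
    have := h _ _ (extend_some_last.2 (s.refl a))
    simp only [he, Fin.castSucc_le_castSucc_iff, false_iff, not_le] at this
    exact this
  · rintro ⟨h, ha⟩
    have main : ∀ y, s a y → ¬ y ≤ e := fun y hy hye => absurd ((h a y hy).2 hye) (not_le.2 ha)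
    intro x y
    refine Fin.lastCases ?_ (fun x => ?_) x <;> refine Fin.lastCases ?_ (fun y => ?_) y
    · exact fun _ => Iff.rfl
    · intro h'
      simp only [he, Fin.castSucc_le_castSucc_iff, main y (extend_some_last.1 h')]
    · intro h'
      simp only [he, Fin.castSucc_le_castSucc_iff,
        main x (extend_some_last.1 ((extend s (some a)).symm h'))]
    · exact fun h' => h _ _ (extend_castSucc.1 h')

/-- A Kreweras class other than the outer one lies on one side of each outer block. -/
theorem le_iff_le_of_kreweras {k : ℕ} {s : Setoid (Fin (k + 1))} {a e f : Fin (k + 1)}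
    (ha : kreweras s (Fin.last k) a) (he : ¬ kreweras s (Fin.last k) e) (hef : kreweras s e f) :
    a ≤ e ↔ a ≤ f := by
  have main : ∀ e f, ¬ kreweras s (Fin.last k) e → kreweras s e f → a ≤ f → a ≤ e := by
    intro e f he hef haf
    by_contra hae
    rw [not_le] at hae
    apply he
    have key : ∀ x y, s x y → x ≤ e → y ≤ e := by
      intro x y hxy hxe
      have h1 := kreweras_last_iff.1 ha x y hxy
      have h2 := hef x y hxy
      simp only [Fin.le_def, Fin.lt_def] at *
      omega
    rw [kreweras_last_iff]
    exact fun x y hxy => ⟨key x y hxy, key y x (s.symm hxy)⟩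
  refine ⟨main f e (fun h => he ((kreweras s).trans h ((kreweras s).symm hef)))
    ((kreweras s).symm hef), main e f he hef⟩

/-! ### The sum of the values over all one-element extensions -/

noncomputable instance {r : ℕ} : Fintype (Setoid (Fin r)) :=
  Fintype.ofInjective (fun s : Setoid (Fin r) => fun p : Fin r × Fin r => s p.1 p.2) fun s t h => by
    ext x y
    exact iff_of_eq (congrFun h (x, y))

/-- The rank of an element in `S` takes each value below `S.card` once. This turns a sum over the
outer class into a convolution. -/
theorem sum_card_filter_lt {α M : Type*} [LinearOrder α] [AddCommMonoid M] (S : Finset α)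
    (F : ℕ → M) :
    ∑ e ∈ S, F (S.filter (· < e)).card = ∑ i ∈ Finset.range S.card, F i := by
  induction S using Finset.induction_on_max with
  | empty => simp
  | insert a S ha ih =>
    have haS : a ∉ S := fun h => lt_irrefl a (ha a h)
    rw [Finset.sum_insert haS, Finset.card_insert_of_notMem haS, Finset.sum_range_succ, ← ih,
      add_comm]
    congr 1
    · refine Finset.sum_congr rfl fun e he => ?_
      rw [Finset.filter_insert, if_neg (ha e he).not_gt]
    · rw [Finset.filter_insert, if_neg (lt_irrefl a), Finset.filter_true_of_mem ha]

/-- The product over the Kreweras classes other than the class of the last edge. -/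
noncomputable def innerWeight (γ : ℝ) {k : ℕ} (s : Setoid (Fin (k + 1))) : ℝ :=
  ∏ e ∈ (eqvClass (kreweras s) (Fin.last k))ᶜ, edgeValue γ s e

/-- A new singleton vertex subdivides an edge of the outer cycle, which becomes longer by one; the
other cycles are unaffected. -/
theorem weight_extend_none (γ : ℝ) {k : ℕ} (s : Setoid (Fin (k + 1))) :
    weight γ (extend s none) =
      innerWeight γ s * A γ ((eqvClass (kreweras s) (Fin.last k)).card + 1) := by
  have hlast : eqvClass (kreweras (extend s none)) (Fin.last (k + 1)) =
      insert (Fin.last (k + 1))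
        ((eqvClass (kreweras s) (Fin.last k)).map Fin.castSuccEmb) := by
    ext f
    refine Fin.lastCases ?_ (fun f => ?_) f
    · simp
    · simp [kreweras_extend_none_last, (Fin.castSucc_lt_last _).ne]
  rw [weight_eq_prod_edgeValue, Fin.prod_univ_castSucc, edgeValue_last, hlast,
    Finset.card_insert_of_notMem (by simp [(Fin.castSucc_lt_last _).ne]), Finset.card_map,
    ← Finset.prod_mul_prod_compl (eqvClass (kreweras s) (Fin.last k))]
  congr 1
  rw [Finset.prod_eq_one, one_mul, innerWeight]
  · refine Finset.prod_congr rfl fun e he => ?_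
    rw [Finset.mem_compl, mem_eqvClass] at he
    refine edgeValue_congr γ (fun f => kreweras_extend_none) fun h => he ?_
    exact kreweras_extend_none_last.1 ((kreweras _).symm h)
  · intro e he
    rw [mem_eqvClass] at he
    exact edgeValue_of_lt γ ((kreweras _).symm (kreweras_extend_none_last.2 he))
      (Fin.castSucc_lt_last e)

/-- Identifying the new vertex with the block of `a` pinches the lengthened outer cycle into two:
the outer edges before `a` together with the new edge, and the outer edges from `a` on. -/
theorem weight_extend_some (γ : ℝ) {k : ℕ} (s : Setoid (Fin (k + 1))) {a : Fin (k + 1)}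
    (ha : kreweras s (Fin.last k) a) :
    weight γ (extend s (some a)) = innerWeight γ s *
      (A γ (((eqvClass (kreweras s) (Fin.last k)).filter (· < a)).card + 1) *
        A γ ((eqvClass (kreweras s) (Fin.last k)).card -
          ((eqvClass (kreweras s) (Fin.last k)).filter (· < a)).card)) := by
  classical
  set O := eqvClass (kreweras s) (Fin.last k) with hO
  have hOmem : ∀ e, e ∈ O ↔ kreweras s (Fin.last k) e := fun e => mem_eqvClass
  have hlast : eqvClass (kreweras (extend s (some a))) (Fin.last (k + 1)) =
      insert (Fin.last (k + 1)) ((O.filter (· < a)).map Fin.castSuccEmb) := by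
    ext f
    refine Fin.lastCases ?_ (fun f => ?_) f
    · simp
    · simp [kreweras_extend_some_last, (Fin.castSucc_lt_last _).ne, hOmem]
  have hcard : O.card - (O.filter (· < a)).card = (O.filter (a ≤ ·)).card := by
    have := Finset.card_filter_add_card_filter_not (s := O) (· < a)
    simp only [not_lt] at this
    omega
  have hin : ∀ e, kreweras s (Fin.last k) e → a ≤ e → ∀ f,
      (kreweras (extend s (some a)) e.castSucc f.castSucc ↔
        kreweras s (Fin.last k) f ∧ a ≤ f) := by
    intro e he hae f
    rw [kreweras_extend_some]
    constructor
    · rintro ⟨h1, h2⟩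
      exact ⟨(kreweras s).trans he h1, h2.1 hae⟩
    · rintro ⟨h1, h2⟩
      exact ⟨(kreweras s).trans ((kreweras s).symm he) h1, iff_of_true hae h2⟩
  have houter : edgeValue γ (extend s (some a)) (Fin.last k).castSucc =
      A γ (O.filter (a ≤ ·)).card := by
    have hnot : ¬ kreweras (extend s (some a)) (Fin.last k).castSucc (Fin.last (k + 1)) := by
      intro h
      have := (kreweras_extend_some_last.1 ((kreweras _).symm h)).2
      exact absurd (Fin.le_last a) (not_le.2 this)
    have hl := hin _ ((kreweras s).refl _) (Fin.le_last a)
    rw [edgeValue, if_pos]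
    · congr 1
      rw [← Finset.card_map Fin.castSuccEmb (s := O.filter (a ≤ ·))]
      congr 1
      ext f
      refine Fin.lastCases ?_ (fun f => ?_) f
      · simp [hnot, (Fin.castSucc_lt_last _).ne]
      · simp [hl, hOmem]
    · intro f
      refine Fin.lastCases (fun h => absurd h hnot) (fun f _ => ?_) f
      exact Fin.le_last f
  rw [weight_eq_prod_edgeValue, Fin.prod_univ_castSucc, edgeValue_last, hlast,
    Finset.card_insert_of_notMem (by simp [(Fin.castSucc_lt_last _).ne]), Finset.card_map,
    ← Finset.prod_mul_prod_compl O, hcard, ← houter]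
  -- Among the old outer edges only the old last edge is maximal in its new class: those before `a`
  -- have joined the new last edge.
  have h1 : ∏ e ∈ O, edgeValue γ (extend s (some a)) e.castSucc =
      edgeValue γ (extend s (some a)) (Fin.last k).castSucc := by
    refine Finset.prod_eq_single_of_mem _ ((hOmem _).2 ((kreweras s).refl _)) fun e he hne => ?_
    rw [hOmem] at he
    rcases lt_or_ge e a with hea | hea
    · exact edgeValue_of_lt γ ((kreweras _).symm (kreweras_extend_some_last.2 ⟨he, hea⟩))
        (Fin.castSucc_lt_last e)
    · refine edgeValue_of_lt γ
        ((hin e he hea (Fin.last k)).2 ⟨(kreweras s).refl _, Fin.le_last a⟩) ?_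
      exact Fin.castSucc_lt_castSucc_iff.2 (lt_of_le_of_ne (Fin.le_last e) hne)
  have h2 : ∏ e ∈ Oᶜ, edgeValue γ (extend s (some a)) e.castSucc = innerWeight γ s := by
    refine Finset.prod_congr rfl fun e he => ?_
    rw [Finset.mem_compl, hOmem] at he
    refine edgeValue_congr γ (fun f => ?_) fun h => he ?_
    · rw [kreweras_extend_some]
      exact ⟨fun h => h.1, fun h => ⟨h, le_iff_le_of_kreweras ha he h⟩⟩
    · exact (kreweras_extend_some_last.1 ((kreweras _).symm h)).1
  rw [h1, h2]
  ring

theorem outer_card_eq_one_of_last_zero {k : ℕ} {s : Setoid (Fin (k + 1))}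
    (h0 : s (Fin.last k) 0) : (eqvClass (kreweras s) (Fin.last k)).card = 1 := by
  rw [eqvClass_kreweras_last_of_last_zero h0, Finset.card_singleton]

/-- The Kreweras successor of the last edge starts in the block of `0`, so it is a second outer edge
unless the last edge is a loop. -/
theorem two_le_outer_card {k : ℕ} {s : Setoid (Fin (k + 1))} (hs : ¬ Crossing s)
    (h0 : ¬ s (Fin.last k) 0) : 2 ≤ (eqvClass (kreweras s) (Fin.last k)).card := by
  obtain ⟨f, hf, hf'⟩ := exists_kreweras_succ hs (Fin.last k)
  rw [Fin.last_add_one] at hf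
  have hne : f ≠ Fin.last k := by
    rintro rfl
    exact h0 (s.symm hf)
  rw [← Finset.card_pair hne]
  refine Finset.card_le_card fun e he => ?_
  rw [Finset.mem_insert, Finset.mem_singleton] at he
  rcases he with rfl | rfl
  · exact mem_eqvClass.2 hf'
  · exact mem_eqvClass.2 ((kreweras s).refl _)

theorem innerWeight_of_last_zero (γ : ℝ) {k : ℕ} {s : Setoid (Fin (k + 1))}
    (h0 : s (Fin.last k) 0) : innerWeight γ s = weight γ (restrict s) := by
  rw [innerWeight, eqvClass_kreweras_last_of_last_zero h0, weight_eq_prod_edgeValue]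
  have : ({Fin.last k} : Finset (Fin (k + 1)))ᶜ = Finset.univ.map Fin.castSuccEmb := by
    ext f
    refine Fin.lastCases ?_ (fun f => ?_) f
    · simp [(Fin.castSucc_lt_last _).ne]
    · simp [(Fin.castSucc_lt_last _).ne]
  rw [this, Finset.prod_map]
  exact Finset.prod_congr rfl fun e _ => edgeValue_restrict_of_last_zero γ h0 e

/-- For `l ≥ 2` this is the defining recursion of `A`, which makes the sum cancel. At `l = 1` the
recursion is not imposed and `A γ 2 + A γ 1 ^ 2` remains. -/
theorem A_convolution (γ : ℝ) {l : ℕ} (hl : 1 ≤ l) :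
    A γ (l + 1) + ∑ i ∈ Finset.range l, A γ (i + 1) * A γ (l - i) =
      if l = 1 then 1 + A γ 1 ^ 2 else 0 := by
  split_ifs with h
  · subst h
    simp [A_two, sq]
  · have hsum : ∑ i ∈ Finset.Icc 1 l, A γ i * A γ (l + 1 - i) =
        ∑ i ∈ Finset.range l, A γ (i + 1) * A γ (l - i) := by
      rw [Finset.range_eq_Ico, ← Finset.Ico_add_one_right_eq_Icc]
      have := Finset.sum_Ico_add' (fun i => A γ i * A γ (l + 1 - i)) 0 l 1
      rw [zero_add] at this
      rw [← this]
      refine Finset.sum_congr rfl fun i _ => ?_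
      rw [Nat.add_sub_add_right]
    rw [A_succ γ l (by omega), hsum, neg_add_cancel]

open Classical in
/-- The sum of the values over all one-element extensions of a partition. -/
theorem sum_setoidValue_extensions (γ : ℝ) {k : ℕ} (s : Setoid (Fin (k + 1))) :
    ∑ t : Setoid (Fin (k + 2)) with restrict t = s, setoidValue γ t =
      if s (Fin.last k) 0 then (1 + A γ 1 ^ 2) * setoidValue γ (restrict s) else 0 := by
  by_cases hs : Crossing s
  · rw [Finset.sum_eq_zero]
    · split_ifs with h0
      · rw [setoidValue, if_pos ((crossing_restrict_of_last_zero h0).2 hs), mul_zero]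
      · rfl
    · intro t ht
      rw [Finset.mem_filter] at ht
      rw [setoidValue, if_pos (Crossing.of_restrict (ht.2 ▸ hs))]
  set O := eqvClass (kreweras s) (Fin.last k) with hO
  have hOmem : ∀ e, e ∈ O ↔ kreweras s (Fin.last k) e := fun e => mem_eqvClass
  have hsub : insert (extend s none) (O.image fun e => extend s (some e)) ⊆
      Finset.univ.filter fun t : Setoid (Fin (k + 2)) => restrict t = s := by
    intro t ht
    rw [Finset.mem_insert, Finset.mem_image] at ht
    rw [Finset.mem_filter]
    rcases ht with rfl | ⟨e, -, rfl⟩ <;> exact ⟨Finset.mem_univ _, restrict_extend _ _⟩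
  -- Only these extensions can be non-crossing, and distinct outer edges start in distinct blocks,
  -- so none is counted twice.
  rw [← Finset.sum_subset hsub, Finset.sum_insert, Finset.sum_image]
  · have hnone : setoidValue γ (extend s none) = innerWeight γ s * A γ (O.card + 1) := by
      rw [setoidValue, if_neg (not_crossing_extend_none hs), weight_extend_none]
    have hsome : ∀ e ∈ O, setoidValue γ (extend s (some e)) = innerWeight γ s *
        (A γ ((O.filter (· < e)).card + 1) * A γ (O.card - (O.filter (· < e)).card)) := by
      intro e he
      rw [hOmem] at he
      rw [setoidValue, if_neg (not_crossing_extend_some hs he), weight_extend_some γ s he]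
    have hpos : 1 ≤ O.card :=
      Finset.card_pos.2 ⟨Fin.last k, (hOmem _).2 ((kreweras s).refl _)⟩
    rw [hnone, Finset.sum_congr rfl hsome, ← Finset.mul_sum,
      sum_card_filter_lt O (fun i => A γ (i + 1) * A γ (O.card - i)), ← mul_add,
      A_convolution γ hpos]
    by_cases h0 : s (Fin.last k) 0
    · rw [if_pos h0, if_pos (outer_card_eq_one_of_last_zero h0), innerWeight_of_last_zero γ h0,
        setoidValue, if_neg fun h => hs ((crossing_restrict_of_last_zero h0).1 h), mul_comm]
    · have := two_le_outer_card hs h0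
      rw [if_neg h0, if_neg (fun h => by rw [hO] at h; omega), mul_zero]
  · intro e he f hf hef
    rw [Finset.mem_coe, hOmem] at he hf
    have : s e f := by
      have h : extend s (some e) (Fin.last (k + 1)) f.castSucc := by
        rw [show extend s (some e) = extend s (some f) from hef, extend_some_last]
      exact extend_some_last.1 h
    exact eq_of_kreweras_of_rel ((kreweras s).trans ((kreweras s).symm he) hf) this
  · intro h
    rw [Finset.mem_image] at h
    obtain ⟨e, -, he⟩ := h
    have h1 : extend s (some e) (Fin.last (k + 1)) e.castSucc := extend_some_last.2 (s.refl e)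
    rw [he] at h1
    exact extend_none_last h1
  · intro t ht hnt
    rw [Finset.mem_filter] at ht
    rw [setoidValue, if_pos]
    by_contra hcr
    apply hnt
    rw [Finset.mem_insert, Finset.mem_image]
    rcases eq_extend_of_not_crossing hcr with h | ⟨e, he, h⟩
    · left
      rw [h, ht.2]
    · right
      rw [ht.2] at he h
      exact ⟨e, (hOmem e).2 he, h.symm⟩

/-- A non-crossing partition has two adjacent equivalent elements or a singleton block. -/
theorem exists_loop_or_singleton {k : ℕ} {s : Setoid (Fin (k + 1))} (hs : ¬ Crossing s) :
    (∃ e, s e (e + 1)) ∨ ∃ e, ∀ x, s e x → x = e := by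
  by_contra hcon
  push Not at hcon
  obtain ⟨hloop, hsing⟩ := hcon
  have key : ∀ a b c d : Fin (k + 1), a < b → b < c → c < d → s a c → s b d → s a b := by
    intro a b c d h1 h2 h3 h4 h5
    by_contra h
    exact hs ⟨a, b, c, d, h1, h2, h3, h4, h5, h⟩
  -- Descent on the distance: an equivalent pair `x < y` encloses the block of `x + 1`, whose second
  -- element `z` yields a closer equivalent pair.
  have main : ∀ d : ℕ, ∀ x y : Fin (k + 1), (y : ℕ) = x + d → x < y → ¬ s x y := by
    intro d
    induction d using Nat.strong_induction_on with
    | _ d ih =>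
      intro x y hd hxy sxy
      have hx : (x : ℕ) ≠ k := by
        have := y.isLt
        rw [Fin.lt_def] at hxy
        omega
      have hv := val_add_one_eq x
      rw [if_neg hx] at hv
      obtain ⟨z, hz, hne⟩ := hsing (x + 1)
      have hxl := hloop x
      have hy : y ≠ x + 1 := by rintro rfl; exact hxl sxy
      have hzx : z ≠ x := by rintro rfl; exact hxl (s.symm hz)
      have hzy : z ≠ y := by rintro rfl; exact hxl (s.trans sxy (s.symm hz))
      have h1 : x < x + 1 := by rw [Fin.lt_def, hv]; omega
      have h2 : x + 1 < y := by
        rw [Ne, Fin.ext_iff, hv] at hy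
        rw [Fin.lt_def] at hxy ⊢
        omega
      rcases lt_or_gt_of_ne hzx with h | h
      · exact hxl (s.trans (s.symm (key z x (x + 1) y h h1 h2 (s.symm hz) sxy)) (s.symm hz))
      rcases lt_or_gt_of_ne hzy with h' | h'
      · rw [Ne, Fin.ext_iff, hv] at hne
        rw [Fin.lt_def] at h h'
        refine ih ((z : ℕ) - (x + 1 : Fin (k + 1))) (by omega) (x + 1) z (by omega) ?_ hz
        rw [Fin.lt_def]
        omega
      · exact hxl (key x (x + 1) y z h1 h2 h' sxy hz)
  obtain ⟨z, hz, hne⟩ := hsing 0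
  have h0 : (0 : Fin (k + 1)) < z := Fin.pos_of_ne_zero hne
  exact main z 0 z (by simp) h0 hz

/-! ### Partition sums of a matrix -/

/-- The product of the entries of `H` along the closed walk `i`. -/
def cyclicProd {n k : ℕ} (H : Matrix (Fin n) (Fin n) ℂ) (i : Fin (k + 1) → Fin n) : ℂ :=
  ∏ e, H (i e) (i (e + 1))

/-- The product of the entries of `H` along the walk `i`. -/
def pathProd {n k : ℕ} (H : Matrix (Fin n) (Fin n) ℂ) (i : Fin (k + 1) → Fin n) : ℂ :=
  ∏ e : Fin k, H (i e.castSucc) (i e.succ)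

theorem cyclicProd_eq {n k : ℕ} (H : Matrix (Fin n) (Fin n) ℂ) (i : Fin (k + 1) → Fin n) :
    cyclicProd H i = pathProd H i * H (i (Fin.last k)) (i 0) := by
  rw [cyclicProd, pathProd, Fin.prod_univ_castSucc, Fin.last_add_one]
  simp_rw [Fin.coeSucc_eq_succ]

theorem pathProd_succ {n k : ℕ} (H : Matrix (Fin n) (Fin n) ℂ) (i : Fin (k + 2) → Fin n) :
    pathProd H i = pathProd H (fun x => i x.castSucc) *
      H (i (Fin.last k).castSucc) (i (Fin.last (k + 1))) := by
  rw [pathProd, pathProd, Fin.prod_univ_castSucc]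
  simp [Fin.succ_last]

open Classical in
/-- The normalized sum over closed walks whose coincidences are described by the setoid `s`. -/
noncomputable def partitionSum {n k : ℕ} (H : Matrix (Fin n) (Fin n) ℂ) (s : Setoid (Fin (k + 1))) :
    ℂ := (1 / (n : ℂ)) * ∑ i : Fin (k + 1) → Fin n with Setoid.ker i = s, cyclicProd H i

theorem partitionSum_comap_add {n k : ℕ} (H : Matrix (Fin n) (Fin n) ℂ)
    (s : Setoid (Fin (k + 1))) (w : Fin (k + 1)) :
    partitionSum H (s.comap (· + w)) = partitionSum H s := by
  classical
  rw [partitionSum, partitionSum]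
  congr 1
  symm
  refine Finset.sum_nbij' (fun i x => i (x + w)) (fun i x => i (x - w)) ?_ ?_ ?_ ?_ ?_
  · intro i hi
    rw [Finset.mem_filter] at hi ⊢
    exact ⟨Finset.mem_univ _, by rw [← hi.2]; rfl⟩
  · intro i hi
    rw [Finset.mem_filter] at hi ⊢
    refine ⟨Finset.mem_univ _, ?_⟩
    ext x y
    have : Setoid.ker i (x - w) (y - w) ↔ s.comap (· + w) (x - w) (y - w) := by rw [hi.2]
    rw [Setoid.comap_rel, sub_add_cancel, sub_add_cancel] at this
    exact this
  · intro i _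
    funext x
    simp
  · intro i _
    funext x
    simp
  · intro i _
    rw [cyclicProd, cyclicProd]
    refine Fintype.prod_equiv (Equiv.subRight w) _ _ fun e => ?_
    rw [Equiv.subRight_apply, sub_add_cancel, sub_add_eq_add_sub, sub_add_cancel]

open Classical in
theorem sum_pathProd_of_last_zero {n k : ℕ} (H : Matrix (Fin n) (Fin n) ℂ)
    {s : Setoid (Fin (k + 2))} (h0 : s (Fin.last (k + 1)) 0) :
    ∑ i : Fin (k + 2) → Fin n with Setoid.ker i = s, pathProd H i =
      ∑ i : Fin (k + 1) → Fin n with Setoid.ker i = restrict s, cyclicProd H i := by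
  have hlast : ∀ i : Fin (k + 2) → Fin n, Setoid.ker i = s → i (Fin.last _) = i 0 := by
    rintro i rfl
    exact h0
  refine Finset.sum_nbij' (fun i x => i x.castSucc)
    (fun i => Fin.snoc (α := fun _ => Fin n) i (i 0)) ?_ ?_ ?_ ?_ ?_
  · intro i hi
    rw [Finset.mem_filter] at hi ⊢
    exact ⟨Finset.mem_univ _, by rw [← hi.2]; rfl⟩
  · intro i hi
    rw [Finset.mem_filter] at hi ⊢
    refine ⟨Finset.mem_univ _, setoid_ext_last ?_ fun x => ?_⟩
    · rw [← hi.2]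
      ext x y
      rw [restrict_iff, Setoid.ker_def, Setoid.ker_def, Fin.snoc_castSucc, Fin.snoc_castSucc]
    · rw [Setoid.ker_def, Fin.snoc_castSucc, Fin.snoc_last, ← Setoid.ker_def (f := i), hi.2,
        restrict_iff]
      exact ⟨fun h => s.trans h0 h, fun h => s.trans (s.symm h0) h⟩
  · intro i hi
    rw [Finset.mem_filter] at hi
    funext x
    refine Fin.lastCases ?_ (fun x => ?_) x
    · rw [Fin.snoc_last, hlast i hi.2]
      rfl
    · rw [Fin.snoc_castSucc]
  · intro i _
    funext x
    rw [Fin.snoc_castSucc]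
  · intro i hi
    rw [Finset.mem_filter] at hi
    rw [pathProd_succ, cyclicProd_eq, hlast i hi.2]
    rfl

theorem partitionSum_of_last_zero {n k : ℕ} {H : Matrix (Fin n) (Fin n) ℂ} {a : ℂ}
    (ha : ∀ x, H x x = a) {s : Setoid (Fin (k + 2))} (h0 : s (Fin.last (k + 1)) 0) :
    partitionSum H s = a * partitionSum H (restrict s) := by
  classical
  rw [partitionSum, partitionSum, ← sum_pathProd_of_last_zero H h0, mul_left_comm]
  refine congrArg _ ?_
  rw [Finset.mul_sum]
  refine Finset.sum_congr rfl fun i hi => ?_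
  rw [Finset.mem_filter] at hi
  have : i (Fin.last _) = i 0 := by
    have h := h0
    rw [← hi.2] at h
    exact h
  rw [cyclicProd_eq, this, ha, mul_comm]

-- The extensions leave the last vertex free, and summing over it turns its two edges into an entry
-- of `H * H`. This entry is `c` if its two neighbours coincide and `0` otherwise.
open Classical in
theorem sum_partitionSum_extensions {n k : ℕ} {H : Matrix (Fin n) (Fin n) ℂ} {c : ℂ}
    (hc : H * H = c • 1) (s : Setoid (Fin (k + 1))) :
    ∑ t : Setoid (Fin (k + 2)) with restrict t = s, partitionSum H t =
      if s (Fin.last k) 0 then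
        c * ((1 / (n : ℂ)) * ∑ i : Fin (k + 1) → Fin n with Setoid.ker i = s, pathProd H i)
      else 0 := by
  have h1 : ∑ t : Setoid (Fin (k + 2)) with restrict t = s,
      ∑ i : Fin (k + 2) → Fin n with Setoid.ker i = t, cyclicProd H i =
      ∑ i : Fin (k + 2) → Fin n with restrict (Setoid.ker i) = s, cyclicProd H i := by
    rw [Finset.sum_filter, Finset.sum_filter]
    simp_rw [Finset.sum_filter]
    have : ∀ t : Setoid (Fin (k + 2)), (if restrict t = s then
        ∑ i : Fin (k + 2) → Fin n, (if Setoid.ker i = t then cyclicProd H i else 0) else 0) =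
        ∑ i : Fin (k + 2) → Fin n, if Setoid.ker i = t then
          (if restrict (Setoid.ker i) = s then cyclicProd H i else 0) else 0 := by
      intro t
      split_ifs with ht
      · refine Finset.sum_congr rfl fun i _ => ?_
        split_ifs with h h'
        · rfl
        · exact absurd (h ▸ ht) h'
        · rfl
      · symm
        refine Finset.sum_eq_zero fun i _ => ?_
        split_ifs with h h'
        · exact absurd (h ▸ h') ht
        · rfl
        · rfl
    simp_rw [this]
    rw [Finset.sum_comm]
    simp
  have h2 : ∑ i : Fin (k + 2) → Fin n with restrict (Setoid.ker i) = s, cyclicProd H i =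
      ∑ i : Fin (k + 1) → Fin n with Setoid.ker i = s,
        pathProd H i * (H * H) (i (Fin.last k)) (i 0) := by
    rw [Finset.sum_filter, Finset.sum_filter,
      ← (Fin.snocEquiv (fun _ : Fin (k + 2) => Fin n)).sum_comp, Fintype.sum_prod_type_right]
    refine Finset.sum_congr rfl fun i _ => ?_
    have hr : ∀ x : Fin n, restrict (Setoid.ker
        (Fin.snocEquiv (fun _ : Fin (k + 2) => Fin n) (x, i))) = Setoid.ker i := by
      intro x
      ext y z
      rw [restrict_iff, Setoid.ker_def, Setoid.ker_def]
      simp [Fin.snocEquiv]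
    simp_rw [hr]
    split_ifs with h
    · rw [Matrix.mul_apply, Finset.mul_sum]
      refine Finset.sum_congr rfl fun x _ => ?_
      rw [cyclicProd_eq, pathProd_succ]
      have h0 : (0 : Fin (k + 2)) = Fin.castSucc 0 := rfl
      rw [h0]
      simp only [Fin.snocEquiv, Equiv.coe_fn_mk, Fin.snoc_castSucc, Fin.snoc_last]
      ring
    · simp
  simp_rw [partitionSum]
  rw [← Finset.mul_sum, h1, h2, hc]
  split_ifs with h0
  · rw [mul_left_comm]
    refine congrArg _ ?_
    rw [Finset.mul_sum]
    refine Finset.sum_congr rfl fun i hi => ?_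
    rw [Finset.mem_filter] at hi
    rw [← hi.2] at h0
    have h0 : i (Fin.last k) = i 0 := h0
    rw [h0, Matrix.smul_apply, Matrix.one_apply_eq, smul_eq_mul, mul_one, mul_comm]
  · rw [Finset.sum_eq_zero, mul_zero]
    intro i hi
    rw [Finset.mem_filter] at hi
    have h0 : i (Fin.last k) ≠ i 0 := by
      intro h
      apply h0
      rw [← hi.2]
      exact h
    rw [Matrix.smul_apply, Matrix.one_apply_ne h0, smul_zero, mul_zero]

/-! ### The size of partition sums without loops and singletons -/

theorem two_mul_card_quotient_le {r : ℕ} {s : Setoid (Fin r)} [Fintype (Quotient s)]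
    (hs : ∀ e, ∃ x, s e x ∧ x ≠ e) : 2 * Fintype.card (Quotient s) ≤ r := by
  classical
  have h := Finset.card_eq_sum_card_fiberwise (s := (Finset.univ : Finset (Fin r)))
    (t := Finset.univ) (f := Quotient.mk s) fun _ _ => Finset.mem_coe.2 (Finset.mem_univ _)
  rw [Finset.card_univ, Fintype.card_fin] at h
  refine le_of_le_of_eq ?_ h.symm
  rw [mul_comm, ← smul_eq_mul, ← Finset.card_univ]
  refine Finset.card_nsmul_le_sum _ _ _ fun q _ => ?_
  induction q using Quotient.inductionOn with
  | _ e =>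
    obtain ⟨x, hx, hne⟩ := hs e
    rw [← Finset.card_pair hne]
    refine Finset.card_le_card fun y hy => ?_
    rw [Finset.mem_insert, Finset.mem_singleton] at hy
    rw [Finset.mem_filter]
    refine ⟨Finset.mem_univ _, Quotient.sound ?_⟩
    rcases hy with rfl | rfl
    · exact s.symm hx
    · exact s.refl _

open Classical in
theorem card_ker_eq_le {r n : ℕ} (s : Setoid (Fin r)) [Fintype (Quotient s)] :
    (Finset.univ.filter fun i : Fin r → Fin n => Setoid.ker i = s).card ≤
      n ^ Fintype.card (Quotient s) := by
  have hsub : (Finset.univ.filter fun i : Fin r → Fin n => Setoid.ker i = s) ⊆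
      (Finset.univ : Finset (Quotient s → Fin n)).image fun g x => g (Quotient.mk s x) := by
    intro i hi
    rw [Finset.mem_filter] at hi
    rw [Finset.mem_image]
    refine ⟨Quotient.lift i fun x y hxy => ?_, Finset.mem_univ _, rfl⟩
    have : Setoid.ker i x y := hi.2 ▸ hxy
    exact this
  refine (Finset.card_le_card hsub).trans (Finset.card_image_le.trans ?_)
  rw [Finset.card_univ, Fintype.card_fun, Fintype.card_fin]

/-- Partitions without loops and singletons have small partition sums. -/
theorem norm_partitionSum_le {n k : ℕ} {H : Matrix (Fin n) (Fin n) ℂ} (hn : 2 ≤ n)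
    (hH : ∀ x y, x ≠ y → ‖H x y‖ ^ 2 ≤ 2 / (n : ℝ)) {s : Setoid (Fin (k + 1))}
    (hloop : ∀ e, ¬ s e (e + 1)) (hsing : ∀ e, ∃ x, s e x ∧ x ≠ e) :
    ‖partitionSum H s‖ ≤ 2 ^ (k + 1) / (n : ℝ) := by
  classical
  have hn0 : (0 : ℝ) < n := by positivity
  set δ : ℝ := √(2 / (n : ℝ)) with hδ
  have hδ0 : 0 ≤ δ := Real.sqrt_nonneg _
  have hδ2 : δ ^ 2 = 2 / (n : ℝ) := Real.sq_sqrt (by positivity)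
  have hδ1 : δ ≤ 1 := by
    rw [hδ, Real.sqrt_le_one, div_le_one hn0]
    exact_mod_cast hn
  set t := Fintype.card (Quotient s)
  have ht : 2 * t ≤ k + 1 := two_mul_card_quotient_le hsing
  have hterm : ∀ i ∈ Finset.univ.filter fun i : Fin (k + 1) → Fin n => Setoid.ker i = s,
      ‖cyclicProd H i‖ ≤ δ ^ (k + 1) := by
    intro i hi
    rw [Finset.mem_filter] at hi
    rw [cyclicProd, norm_prod]
    refine (Finset.prod_le_prod (fun _ _ => norm_nonneg _) fun e _ =>
      (Real.le_sqrt (norm_nonneg _) ?_).2 (hH _ _ ?_)).trans_eq ?_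
    · positivity
    · intro h
      apply hloop e
      rw [← hi.2]
      exact h
    · rw [Finset.prod_const, Finset.card_univ, Fintype.card_fin]
  have hsum := norm_sum_le_of_le _ hterm
  rw [Finset.sum_const, nsmul_eq_mul] at hsum
  rw [partitionSum, norm_mul, norm_div, norm_one, Complex.norm_natCast, one_div_mul_eq_div]
  gcongr
  -- There are at most `n ^ t` walks. Since `δ ≤ 1`, the exponent `k + 1` can be lowered to `2 * t`,
  -- and each block then costs `n * δ ^ 2 = 2`.
  calc _ ≤ _ := hsum
    _ ≤ (n : ℝ) ^ t * δ ^ (2 * t) := by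
      gcongr ?_ * ?_
      · exact_mod_cast card_ker_eq_le s
      · exact pow_le_pow_of_le_one hδ0 hδ1 ht
    _ = 2 ^ t := by
      rw [pow_mul, hδ2, ← mul_pow, mul_div_cancel₀ _ hn0.ne']
    _ ≤ 2 ^ (k + 1) := pow_le_pow_right₀ one_le_two (by omega)

/-! ### Convergence of the partition sums -/

theorem setoidValue_comap_add (γ : ℝ) {k : ℕ} (s : Setoid (Fin (k + 1))) (w : Fin (k + 1)) :
    setoidValue γ (s.comap (· + w)) = setoidValue γ s := by
  have key : ∀ j : ℕ, setoidValue γ (s.comap (· + j • (1 : Fin (k + 1)))) = setoidValue γ s := by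
    intro j
    induction j with
    | zero =>
      congr 1
      ext x y
      simp [Setoid.comap_rel]
    | succ j ih =>
      rw [← ih, ← setoidValue_rotate γ (s.comap fun x => x + j • (1 : Fin (k + 1)))]
      congr 1
      ext x y
      change s (x + (j + 1) • 1) (y + (j + 1) • 1) ↔ s (x + 1 + j • 1) (y + 1 + j • 1)
      rw [succ_nsmul', add_assoc, add_assoc]
  obtain ⟨j, hj⟩ : ∃ j : ℕ, j • (1 : Fin (k + 1)) = w := by
    have : ∀ j : ℕ, j < k + 1 → ((j • (1 : Fin (k + 1)) : Fin (k + 1)) : ℕ) = j := by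
      intro j
      induction j with
      | zero => simp
      | succ j ih =>
        intro hj
        rw [succ_nsmul, val_add_one_eq, ih (by omega), if_neg (by omega)]
    exact ⟨w, Fin.ext (this w w.isLt)⟩
  rw [← hj, key]

/-- The matrix has constant diagonal `a`, square `c`, and off-diagonal entries of order
`n ^ (-1/2)`. -/
structure IsFlat {n : ℕ} (H : Matrix (Fin n) (Fin n) ℂ) (a c : ℂ) : Prop where
  two_le : 2 ≤ n
  diag : ∀ x, H x x = a
  mul_self : H * H = c • 1
  offDiag : ∀ x y, x ≠ y → ‖H x y‖ ^ 2 ≤ 2 / (n : ℝ)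

theorem sum_pathProd_zero {n : ℕ} (H : Matrix (Fin n) (Fin n) ℂ) (hn : n ≠ 0)
    (s : Setoid (Fin 1)) : open Classical in
    (1 / (n : ℂ)) * ∑ i : Fin 1 → Fin n with Setoid.ker i = s, pathProd H i = 1 := by
  classical
  have : ∀ i : Fin 1 → Fin n, Setoid.ker i = s := by
    intro i
    ext x y
    rw [Subsingleton.elim x y]
    exact iff_of_true rfl (s.refl _)
  have hn' : (n : ℂ) ≠ 0 := Nat.cast_ne_zero.2 hn
  simp [this, pathProd, hn']

theorem setoidValue_fin_zero (γ : ℝ) (s : Setoid (Fin 0)) : setoidValue γ s = 1 := by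
  rw [setoidValue, if_neg, weight]
  · simp
  · rintro ⟨a, -⟩
    exact a.elim0

section Convergence

variable {n : ℕ → ℕ} {H : ∀ i, Matrix (Fin (n i)) (Fin (n i)) ℂ} {a c : ℕ → ℂ} {γ : ℝ}

theorem tendsto_partitionSum_of_last_zero (hH : ∀ᶠ i in atTop, IsFlat (H i) (a i) (c i))
    (ha : Tendsto a atTop (𝓝 ((A γ 1 : ℝ) : ℂ))) {k : ℕ}
    (ih : ∀ l < k, ∀ s : Setoid (Fin (l + 1)),
      Tendsto (fun i => partitionSum (H i) s) atTop (𝓝 ((setoidValue γ s : ℝ) : ℂ)))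
    {s : Setoid (Fin (k + 1))} (h0 : s (Fin.last k) 0) :
    Tendsto (fun i => partitionSum (H i) s) atTop (𝓝 ((setoidValue γ s : ℝ) : ℂ)) := by
  classical
  rw [setoidValue_of_last_zero γ h0, Complex.ofReal_mul]
  cases k with
  | zero =>
    rw [setoidValue_fin_zero, Complex.ofReal_one, mul_one]
    refine ha.congr' ?_
    filter_upwards [hH] with i hi
    have h1 := sum_pathProd_zero (H i) (by have := hi.two_le; omega) s
    have h2 : ∀ x : Fin 1 → Fin (n i), cyclicProd (H i) x = a i * pathProd (H i) x := by
      intro x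
      rw [cyclicProd_eq, mul_comm]
      congr 1
      exact hi.diag _
    rw [partitionSum]
    simp_rw [h2]
    rw [← Finset.mul_sum, mul_left_comm, h1, mul_one]
  | succ k =>
    refine (ha.mul (ih k (Nat.lt_succ_self k) (restrict s))).congr' ?_
    filter_upwards [hH] with i hi
    rw [partitionSum_of_last_zero hi.diag h0]

-- The sums on both sides have the same form, `c` respectively its limit times a quantity for a
-- shorter partition. For `k = 0` that partition is empty, with value `1`, and needs a separate
-- case.
open Classical in
theorem tendsto_sum_extensions (hH : ∀ᶠ i in atTop, IsFlat (H i) (a i) (c i))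
    (hc : Tendsto c atTop (𝓝 ((1 + A γ 1 ^ 2 : ℝ) : ℂ))) {k : ℕ}
    (ih : ∀ l < k, ∀ s : Setoid (Fin (l + 1)),
      Tendsto (fun i => partitionSum (H i) s) atTop (𝓝 ((setoidValue γ s : ℝ) : ℂ)))
    (s : Setoid (Fin (k + 1))) :
    Tendsto (fun i => ∑ t : Setoid (Fin (k + 2)) with restrict t = s, partitionSum (H i) t) atTop
      (𝓝 ((∑ t : Setoid (Fin (k + 2)) with restrict t = s, setoidValue γ t : ℝ) : ℂ)) := by
  rw [sum_setoidValue_extensions]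
  by_cases h0 : s (Fin.last k) 0
  · rw [if_pos h0, Complex.ofReal_mul]
    cases k with
    | zero =>
      rw [setoidValue_fin_zero, Complex.ofReal_one, mul_one]
      refine hc.congr' ?_
      filter_upwards [hH] with i hi
      rw [sum_partitionSum_extensions hi.mul_self, if_pos h0,
        sum_pathProd_zero (H i) (by have := hi.two_le; omega) s, mul_one]
    | succ k =>
      refine (hc.mul (ih k (Nat.lt_succ_self k) (restrict s))).congr' ?_
      filter_upwards [hH] with i hi
      rw [sum_partitionSum_extensions hi.mul_self, if_pos h0, sum_pathProd_of_last_zero _ h0,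
        partitionSum]
  · rw [if_neg h0, Complex.ofReal_zero]
    refine tendsto_const_nhds.congr' ?_
    filter_upwards [hH] with i hi
    rw [sum_partitionSum_extensions hi.mul_self, if_neg h0]

/-- The partition sums of a sequence of flat matrices converge to the values of the partitions. -/
theorem tendsto_partitionSum (hn : Tendsto n atTop atTop)
    (hH : ∀ᶠ i in atTop, IsFlat (H i) (a i) (c i))
    (ha : Tendsto a atTop (𝓝 ((A γ 1 : ℝ) : ℂ)))
    (hc : Tendsto c atTop (𝓝 ((1 + A γ 1 ^ 2 : ℝ) : ℂ))) (k : ℕ) (s : Setoid (Fin (k + 1))) :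
    Tendsto (fun i => partitionSum (H i) s) atTop (𝓝 ((setoidValue γ s : ℝ) : ℂ)) := by
  classical
  induction k using Nat.strong_induction_on with
  | _ k ihk =>
  -- Larger setoids are coarser, so the hypothesis covers all strictly coarser partitions.
  induction s using WellFoundedGT.induction with
  | _ s ihs =>
  have hshift : ∀ (w : Fin (k + 1)) (s : Setoid (Fin (k + 1))),
      Tendsto (fun i => partitionSum (H i) (s.comap (· + w))) atTop
        (𝓝 ((setoidValue γ (s.comap (· + w)) : ℝ) : ℂ)) →
      Tendsto (fun i => partitionSum (H i) s) atTop (𝓝 ((setoidValue γ s : ℝ) : ℂ)) := by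
    intro w s h
    simpa only [partitionSum_comap_add, setoidValue_comap_add] using h
  have hlast : ∀ e : Fin (k + 1), Fin.last k + (e + 1) = e := by
    intro e
    rw [add_comm e, ← add_assoc, Fin.last_add_one, zero_add]
  by_cases hloop : ∃ e, s e (e + 1)
  · obtain ⟨e, he⟩ := hloop
    -- This shift takes the last element to `e` and `0` to `e + 1`.
    apply hshift (e + 1)
    refine tendsto_partitionSum_of_last_zero hH ha ihk ?_
    rw [Setoid.comap_rel, hlast, zero_add]
    exact he
  push Not at hloop
  by_cases hsing : ∃ e, ∀ x, s e x → x = e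
  · obtain ⟨e, he⟩ := hsing
    cases k with
    | zero =>
      have h1 : e + 1 = e := Subsingleton.elim (α := Fin 1) _ _
      exact absurd (s.refl e) (by have := hloop e; rwa [h1] at this)
    | succ k =>
    apply hshift (e + 1)
    set s' := s.comap (· + (e + 1)) with hs'
    have hs'last : ∀ x : Fin (k + 1), ¬ s' (Fin.last _) x.castSucc := by
      intro x hx
      rw [hs', Setoid.comap_rel, hlast] at hx
      have h1 := he _ hx
      rw [← hlast e, hlast e] at h1
      have h2 : x.castSucc = Fin.last (k + 1) := by
        rw [← add_left_inj (e + 1), h1, hlast]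
      exact (Fin.castSucc_lt_last x).ne h2
    -- The induction hypothesis is about partitions coarser than `s`; undoing the rotation transfers
    -- it to those coarser than `s'`.
    have hlarger : ∀ t, s' < t →
        Tendsto (fun i => partitionSum (H i) t) atTop (𝓝 ((setoidValue γ t : ℝ) : ℂ)) := by
      intro t ht
      have hcancel : (t.comap (· - (e + 1))).comap (· + (e + 1)) = t := by
        ext x y
        rw [Setoid.comap_rel, Setoid.comap_rel, add_sub_cancel_right, add_sub_cancel_right]
      have hlt : s < t.comap (· - (e + 1)) := by
        refine lt_of_le_of_ne ?_ ?_
        · intro x y hxy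
          rw [Setoid.comap_rel]
          apply ht.le
          rw [hs', Setoid.comap_rel, sub_add_cancel, sub_add_cancel]
          exact hxy
        · intro h
          apply ht.ne
          rw [hs', h, hcancel]
      have h1 : ∀ i, partitionSum (H i) (t.comap (· - (e + 1))) = partitionSum (H i) t := by
        intro i
        rw [← partitionSum_comap_add _ _ (e + 1), hcancel]
      have h2 : setoidValue γ (t.comap (· - (e + 1))) = setoidValue γ t := by
        rw [← setoidValue_comap_add γ _ (e + 1), hcancel]
      have h3 := ihs _ hlt
      simp_rw [h1, h2] at h3
      exact h3
    have hmem : s' ∈ Finset.univ.filter fun t => restrict t = restrict s' := by simp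
    have hsum := tendsto_sum_extensions hH hc
      (fun l hl => ihk l (hl.trans (Nat.lt_succ_self k))) (restrict s')
    -- In `s'` the last element is alone, so every other extension of `restrict s'` is strictly
    -- coarser. Subtracting these from the full sum leaves `s'`.
    have hrest : Tendsto (fun i => ∑ t ∈ (Finset.univ.filter fun t : Setoid (Fin (k + 2)) =>
        restrict t = restrict s').erase s', partitionSum (H i) t) atTop
        (𝓝 (∑ t ∈ (Finset.univ.filter fun t : Setoid (Fin (k + 2)) =>
        restrict t = restrict s').erase s', ((setoidValue γ t : ℝ) : ℂ))) := by
      refine tendsto_finsetSum _ fun t ht => hlarger t ?_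
      rw [Finset.mem_erase, Finset.mem_filter] at ht
      obtain ⟨hne, -, hres⟩ := ht
      refine lt_of_le_of_ne ?_ hne.symm
      intro x y
      refine Fin.lastCases ?_ (fun x => ?_) x <;> refine Fin.lastCases ?_ (fun y => ?_) y
      · exact fun _ => t.refl _
      · exact fun h => absurd h (hs'last y)
      · exact fun h => absurd (s'.symm h) (hs'last x)
      · intro h
        rw [← restrict_iff] at h ⊢
        rwa [hres]
    have hdiff := hsum.sub hrest
    rw [Complex.ofReal_sum, ← Finset.add_sum_erase _ _ hmem, add_sub_cancel_right] at hdiff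
    refine hdiff.congr fun i => ?_
    rw [← Finset.add_sum_erase _ _ hmem, add_sub_cancel_right]
  · push Not at hsing
    have hcr : Crossing s := by
      by_contra hcr
      rcases exists_loop_or_singleton hcr with ⟨e, he⟩ | ⟨e, he⟩
      · exact hloop e he
      · obtain ⟨x, hx, hne⟩ := hsing e
        exact hne (he x hx)
    rw [setoidValue, if_pos hcr, Complex.ofReal_zero]
    refine squeeze_zero_norm' (a := fun i => 2 ^ (k + 1) / (n i : ℝ)) ?_ ?_
    · filter_upwards [hH] with i hi
      exact norm_partitionSum_le hi.two_le hi.offDiag hloop hsing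
    · exact (tendsto_natCast_atTop_atTop.comp hn).const_div_atTop _

end Convergence

/-! ### Traces of powers and expectations -/

/-- The arbitrary factor `N` lets the induction absorb one factor `M` at a time. -/
theorem sum_pathProd_mul {n : ℕ} (M N : Matrix (Fin n) (Fin n) ℂ) (k : ℕ) :
    ∑ i : Fin (k + 1) → Fin n, pathProd M i * N (i (Fin.last k)) (i 0) = (M ^ k * N).trace := by
  induction k generalizing N with
  | zero =>
    rw [pow_zero, one_mul, Matrix.trace]
    refine Fintype.sum_equiv (Equiv.funUnique (Fin 1) (Fin n)) _ _ fun i => ?_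
    simp [pathProd]
  | succ k ih =>
    rw [pow_succ, mul_assoc, ← ih, ← (Fin.snocEquiv (fun _ : Fin (k + 2) => Fin n)).sum_comp,
      Fintype.sum_prod_type_right]
    refine Finset.sum_congr rfl fun i _ => ?_
    rw [Matrix.mul_apply, Finset.mul_sum]
    refine Finset.sum_congr rfl fun x _ => ?_
    rw [pathProd_succ]
    have h0 : (0 : Fin (k + 2)) = Fin.castSucc 0 := rfl
    rw [h0]
    simp only [Fin.snocEquiv, Equiv.coe_fn_mk, Fin.snoc_castSucc, Fin.snoc_last]
    ring

theorem trace_pow_succ {n : ℕ} (M : Matrix (Fin n) (Fin n) ℂ) (k : ℕ) :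
    (M ^ (k + 1)).trace = ∑ i : Fin (k + 1) → Fin n, cyclicProd M i := by
  rw [pow_succ, ← sum_pathProd_mul]
  simp_rw [cyclicProd_eq]

theorem mul_pow_succ_comm {m n : ℕ} (X : Matrix (Fin m) (Fin n) ℂ) (Y : Matrix (Fin n) (Fin m) ℂ)
    (k : ℕ) : (X * Y) ^ (k + 1) = X * ((Y * X) ^ k * Y) := by
  induction k with
  | zero => simp
  | succ k ih => rw [pow_succ', ih, pow_succ' (Y * X)]; simp only [Matrix.mul_assoc]

theorem trace_mul_pow_succ {m n : ℕ} (X : Matrix (Fin m) (Fin n) ℂ)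
    (Y : Matrix (Fin n) (Fin m) ℂ) (k : ℕ) :
    ((X * Y) ^ (k + 1)).trace = ((Y * X) ^ (k + 1)).trace := by
  rw [mul_pow_succ_comm, Matrix.trace_mul_comm, Matrix.mul_assoc, ← pow_succ]

theorem selection_mul_self {n : ℕ} (S : Set (Fin n)) : selection S * selection S = selection S := by
  rw [selection, Matrix.diagonal_mul_diagonal]
  congr 1
  funext i
  split_ifs <;> simp

theorem selection_pow_succ {n : ℕ} (S : Set (Fin n)) (k : ℕ) :
    selection S ^ (k + 1) = selection S := by
  induction k with
  | zero => simp
  | succ k ih => rw [pow_succ, ih, selection_mul_self]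

open Classical in
theorem cyclicProd_mul_selection {n k : ℕ} (H : Matrix (Fin n) (Fin n) ℂ) (S : Set (Fin n))
    (i : Fin (k + 1) → Fin n) :
    cyclicProd (H * selection S) i =
      cyclicProd H i * if (↑(Finset.univ.image i) : Set (Fin n)) ⊆ S then 1 else 0 := by
  rw [cyclicProd, cyclicProd, selection]
  simp_rw [Matrix.mul_diagonal]
  rw [Finset.prod_mul_distrib]
  congr 1
  rw [Fintype.prod_equiv (Equiv.addRight (1 : Fin (k + 1)))
    (fun e => if i (e + 1) ∈ S then (1 : ℂ) else 0)
    (fun e => if i e ∈ S then (1 : ℂ) else 0) fun e => rfl, Finset.prod_ite_zero]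
  simp [Set.range_subset_iff]

open Classical in
theorem integral_subset {n : ℕ} (p : unitInterval) (C : Finset (Fin n)) :
    ∫ S, (if (C : Set (Fin n)) ⊆ S then (1 : ℂ) else 0)
      ∂(setBernoulli (Set.univ : Set (Fin n)) p) = (p : ℂ) ^ C.card := by
  have hm : (setBernoulli (Set.univ : Set (Fin n)) p).real {S | (C : Set (Fin n)) ⊆ S} =
      (p : ℝ) ^ C.card := by
    rw [measureReal_def, setBernoulli_apply']
    have : ((fun q : Fin n → Prop => {i | q i}) ⁻¹' {S | (C : Set (Fin n)) ⊆ S}) =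
        Set.pi C fun _ => {True} := by
      ext q
      simp [Set.subset_def, Set.pi]
    rw [this, Measure.infinitePi_pi]
    · simp
    · intro i _
      exact MeasurableSet.of_discrete
  have hi : (fun S : Set (Fin n) => if (C : Set (Fin n)) ⊆ S then (1 : ℂ) else 0) =
      Set.indicator {S | (C : Set (Fin n)) ⊆ S} fun _ => 1 := by
    funext S
    simp [Set.indicator]
  rw [hi, integral_indicator_const _ (Set.toFinite _).measurableSet, hm]
  simp

/-- The number of blocks of a setoid. -/
noncomputable def numBlocks {r : ℕ} (s : Setoid (Fin r)) : ℕ := Nat.card (Quotient s)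

theorem numBlocks_ker {r : ℕ} {α : Type*} [DecidableEq α] (f : Fin r → α) :
    numBlocks (Setoid.ker f) = (Finset.univ.image f).card := by
  rw [numBlocks, Nat.card_congr (Setoid.quotientKerEquivRange f), Nat.card_coe_set_eq,
    ← Set.ncard_coe_finset]
  simp

/-- A closed walk survives when all its vertices are selected, with probability `p` to the number of
distinct vertices, which is the number of blocks of its kernel. -/
theorem integral_trace_pow {n : ℕ} (H : Matrix (Fin n) (Fin n) ℂ) (p : unitInterval) (k : ℕ) :
    (1 / (n : ℂ)) * ∫ S, ((H * selection S) ^ (k + 1)).trace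
      ∂(setBernoulli (Set.univ : Set (Fin n)) p) =
      ∑ s : Setoid (Fin (k + 1)), (p : ℂ) ^ numBlocks s * partitionSum H s := by
  classical
  simp_rw [trace_pow_succ, cyclicProd_mul_selection]
  rw [integral_finsetSum _ fun _ _ => Integrable.of_finite]
  simp_rw [integral_const_mul, integral_subset, partitionSum]
  simp_rw [mul_left_comm ((p : ℂ) ^ _) (1 / (n : ℂ))]
  rw [← Finset.mul_sum]
  congr 1
  simp_rw [Finset.mul_sum, Finset.sum_filter]
  rw [Finset.sum_comm]
  refine Finset.sum_congr rfl fun i _ => ?_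
  rw [Finset.sum_ite_eq, if_pos (Finset.mem_univ _), numBlocks_ker, mul_comm]

theorem integral_trace_selection {n : ℕ} (hn : n ≠ 0) (p : unitInterval) :
    (1 / (n : ℂ)) * ∫ S, (selection S).trace ∂(setBernoulli (Set.univ : Set (Fin n)) p) =
      (p : ℂ) := by
  classical
  have h : ∀ S : Set (Fin n), (selection S).trace =
      ∑ x, if (↑({x} : Finset (Fin n)) : Set (Fin n)) ⊆ S then (1 : ℂ) else 0 := by
    intro S
    simp [selection, Matrix.trace_diagonal]
  simp_rw [h]
  rw [integral_finsetSum _ fun _ _ => Integrable.of_finite]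
  simp_rw [integral_subset]
  have hn' : (n : ℂ) ≠ 0 := Nat.cast_ne_zero.2 hn
  simp [hn']

/-- Decentralization: the moments of `F` in terms of those of `H`, where `F† F = b H + d`. -/
theorem trace_moment {m n : ℕ} {F : Matrix (Fin m) (Fin n) ℂ} {H : Matrix (Fin n) (Fin n) ℂ}
    {b d : ℂ} (hG : Fᴴ * F = b • H + d • 1) (S : Set (Fin n)) {r : ℕ} (hr : 1 ≤ r) :
    ((F * selection S * Fᴴ) ^ r).trace = d ^ r * (selection S).trace +
      ∑ j ∈ Finset.Icc 1 r, (r.choose j : ℂ) *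
        (b ^ j * d ^ (r - j) * ((H * selection S) ^ j).trace) := by
  obtain ⟨k, rfl⟩ : ∃ k, r = k + 1 := ⟨r - 1, by omega⟩
  set P := selection S with hP
  have hPP : P * P = P := selection_mul_self S
  have h1 : F * P * Fᴴ = (F * P) * (P * Fᴴ) := by
    rw [Matrix.mul_assoc F P (P * Fᴴ), ← Matrix.mul_assoc P P, hPP, ← Matrix.mul_assoc]
  have h2 : (P * Fᴴ) * (F * P) = b • (P * (H * P)) + d • P := by
    rw [Matrix.mul_assoc, ← Matrix.mul_assoc Fᴴ, hG]
    simp [Matrix.add_mul, Matrix.mul_add, hPP]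
  have hcomm : Commute (b • (P * (H * P))) (d • P) := by
    rw [commute_iff_eq]
    simp only [Matrix.smul_mul, Matrix.mul_smul, Matrix.mul_assoc, hPP]
    rw [← Matrix.mul_assoc P P, hPP, smul_comm]
  -- Cyclicity of the trace replaces `F P F†` by `P F† F P`, a sum of two commuting matrices. The
  -- term `j = 0` is split off, since it contains only a power of `P`.
  rw [h1, trace_mul_pow_succ, h2, hcomm.add_pow, Matrix.trace_sum, Finset.sum_range_succ']
  rw [add_comm]
  congr 1
  · rw [smul_pow d, hP, tsub_zero, selection_pow_succ]
    simp
  · rw [Finset.range_eq_Ico, Finset.sum_Ico_add' (fun j => (((b • (P * (H * P))) ^ j *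
      (d • P) ^ (k + 1 - j) * ((k + 1).choose j : Matrix (Fin n) (Fin n) ℂ)).trace)),
      zero_add, Finset.Ico_add_one_right_eq_Icc]
    refine Finset.sum_congr rfl fun j hj => ?_
    rw [Finset.mem_Icc] at hj
    obtain ⟨l, rfl⟩ : ∃ l, j = l + 1 := ⟨j - 1, by omega⟩
    have h3 : ∀ q : ℕ, (P * (H * P)) ^ (l + 1) * P ^ q = (P * (H * P)) ^ (l + 1) := by
      intro q
      induction q with
      | zero => simp
      | succ q ih =>
        rw [pow_succ P, ← mul_assoc, ih, pow_succ]
        simp only [mul_assoc, hPP]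
    have h4 : ((P * (H * P)) ^ (l + 1)).trace = ((H * P) ^ (l + 1)).trace := by
      rw [trace_mul_pow_succ, mul_assoc, hPP]
    rw [smul_pow, smul_pow, Matrix.smul_mul, Matrix.mul_smul, h3, ← nsmul_eq_mul', Matrix.trace_smul,
      Matrix.trace_smul, Matrix.trace_smul, h4]
    simp only [nsmul_eq_mul, smul_eq_mul]
    ring

theorem expectedMoment_eq {m n : ℕ} (hn : n ≠ 0) {F : Matrix (Fin m) (Fin n) ℂ}
    {H : Matrix (Fin n) (Fin n) ℂ} {b d : ℂ} (hG : Fᴴ * F = b • H + d • 1) (p : unitInterval)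
    {r : ℕ} (hr : 1 ≤ r) :
    expectedMoment F p r = d ^ r * (p : ℂ) + ∑ j ∈ Finset.Icc 1 r, (r.choose j : ℂ) *
      (b ^ j * d ^ (r - j) * ((1 / (n : ℂ)) * ∫ S, ((H * selection S) ^ j).trace
        ∂(setBernoulli (Set.univ : Set (Fin n)) p))) := by
  rw [expectedMoment]
  simp_rw [trace_moment hG _ hr]
  rw [integral_add Integrable.of_finite Integrable.of_finite,
    integral_finsetSum _ fun _ _ => Integrable.of_finite, mul_add, integral_const_mul,
    mul_left_comm, integral_trace_selection hn, Finset.mul_sum]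
  congr 1
  refine Finset.sum_congr rfl fun j _ => ?_
  rw [integral_const_mul, integral_const_mul]
  ring

/-! ### The limit polynomial -/

theorem blockSetoid_bijective (r : ℕ) : Function.Bijective (blockSetoid : Part r → _) := by
  classical
  have hmem : ∀ (π : Part r) (x y : Fin r), y ∈ π.part x ↔ blockSetoid π x y := by
    intro π x y
    rw [blockSetoid_iff]
    constructor
    · intro h
      exact (π.part_eq_of_mem (π.part_mem.2 (Finset.mem_univ x)) h).symm
    · intro h
      rw [h]
      exact π.mem_part (Finset.mem_univ y)
  constructor
  · intro π π' h
    have hpart : π.part = π'.part := by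
      funext x
      ext y
      rw [hmem, hmem, h]
    ext B
    constructor
    · intro hB
      obtain ⟨x, hx⟩ := π.nonempty_of_mem_parts hB
      rw [← π.part_eq_of_mem hB hx, hpart]
      exact π'.part_mem.2 (Finset.mem_univ x)
    · intro hB
      obtain ⟨x, hx⟩ := π'.nonempty_of_mem_parts hB
      rw [← π'.part_eq_of_mem hB hx, ← hpart]
      exact π.part_mem.2 (Finset.mem_univ x)
  · intro s
    refine ⟨Finpartition.ofSetoid s, ?_⟩
    ext x y
    rw [← hmem, Finpartition.mem_part_ofSetoid_iff_rel]

theorem numBlocks_blockSetoid {r : ℕ} (π : Part r) : numBlocks (blockSetoid π) = π.parts.card := by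
  classical
  rw [blockSetoid, numBlocks_ker]
  congr 1
  ext B
  simp only [Finset.mem_image, Finset.mem_univ, true_and]
  constructor
  · rintro ⟨x, rfl⟩
    exact π.part_mem.2 (Finset.mem_univ x)
  · intro hB
    obtain ⟨x, hx⟩ := π.nonempty_of_mem_parts hB
    exact ⟨x, π.part_eq_of_mem hB hx⟩

theorem mCentral_eq (k : ℕ) (γ p : ℝ) :
    mCentral (k + 1) γ p = ∑ s : Setoid (Fin (k + 1)), p ^ numBlocks s * setoidValue γ s := by
  classical
  have hmaps : ∀ π ∈ (Finset.univ : Finset (Part (k + 1))),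
      π.parts.card ∈ Finset.Icc 1 (k + 1) := by
    intro π _
    rw [Finset.mem_Icc]
    refine ⟨Finset.card_pos.2 ⟨_, π.part_mem.2 (Finset.mem_univ 0)⟩, ?_⟩
    simpa using π.card_parts_le_card
  rw [mCentral, ← (Equiv.ofBijective _ (blockSetoid_bijective (k + 1))).sum_comp,
    ← Finset.sum_fiberwise_of_maps_to hmaps]
  refine Finset.sum_congr rfl fun t _ => ?_
  rw [Finset.sum_mul]
  refine Finset.sum_congr rfl fun π hπ => ?_
  rw [Finset.mem_filter] at hπ
  rw [Equiv.ofBijective_apply, numBlocks_blockSetoid, hπ.2, value_eq_setoidValue, mul_comm]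

/-! ### Equiangular tight frames -/

/-- The centralized and normalized Gram matrix of a frame with redundancy `ρ`. -/
noncomputable def centralGram {m n : ℕ} (F : Matrix (Fin m) (Fin n) ℂ) (ρ : ℝ) :
    Matrix (Fin n) (Fin n) ℂ :=
  ((√(ρ - 1) : ℝ) : ℂ)⁻¹ • (Fᴴ * F - ((ρ / 2 : ℝ) : ℂ) • 1)

theorem gram_eq {m n : ℕ} (F : Matrix (Fin m) (Fin n) ℂ) {ρ : ℝ} (hρ : 1 < ρ) :
    Fᴴ * F = ((√(ρ - 1) : ℝ) : ℂ) • centralGram F ρ + ((ρ / 2 : ℝ) : ℂ) • 1 := by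
  have hb : ((√(ρ - 1) : ℝ) : ℂ) ≠ 0 :=
    Complex.ofReal_ne_zero.2 (Real.sqrt_pos.2 (by linarith)).ne'
  rw [centralGram, smul_smul, mul_inv_cancel₀ hb, one_smul, sub_add_cancel]

theorem gram_diag {m n : ℕ} (F : Matrix (Fin m) (Fin n) ℂ) (x : Fin n) :
    (Fᴴ * F) x x = ((∑ j, ‖F j x‖ ^ 2 : ℝ) : ℂ) := by
  rw [Matrix.mul_apply, Complex.ofReal_sum]
  refine Finset.sum_congr rfl fun j _ => ?_
  rw [Matrix.conjTranspose_apply, Complex.star_def, Complex.conj_mul', Complex.ofReal_pow]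

theorem IsETF.gram_diag_eq_one {m n : ℕ} {F : Matrix (Fin m) (Fin n) ℂ} (hF : IsETF F)
    (x : Fin n) : (Fᴴ * F) x x = 1 := by
  obtain ⟨ν, ρ, -, -, hG, -⟩ := hF
  have h := hG x x
  rw [if_pos rfl, gram_diag, Complex.norm_real, Real.norm_of_nonneg (by positivity)] at h
  rw [gram_diag, h, Complex.ofReal_one]

/-- Comparing the traces of `F F†` and `F† F` determines the frame constant: `ρ m = n`. -/
theorem IsETF.mul_conjTranspose {m n : ℕ} {F : Matrix (Fin m) (Fin n) ℂ} (hF : IsETF F)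
    (hm : m ≠ 0) : F * Fᴴ = (((n : ℝ) / m : ℝ) : ℂ) • 1 := by
  have htr : (Fᴴ * F).trace = n := by
    rw [Matrix.trace]
    simp [hF.gram_diag_eq_one]
  obtain ⟨ν, ρ, -, -, -, hρ⟩ := hF
  rw [Matrix.trace_mul_comm, hρ, Matrix.trace_smul, Matrix.trace_one, Fintype.card_fin,
    smul_eq_mul] at htr
  have hm' : (m : ℂ) ≠ 0 := Nat.cast_ne_zero.2 hm
  rw [hρ]
  congr 1
  push_cast
  rw [eq_div_iff hm', htr]

/-- The diagonal of `G² = ρ G`, with `G = F† F`, reads `1 + (n - 1) ν² = ρ`. -/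
theorem IsETF.norm_sq_gram {m n : ℕ} {F : Matrix (Fin m) (Fin n) ℂ} (hF : IsETF F)
    (hm : m ≠ 0) {x y : Fin n} (hxy : x ≠ y) :
    ((n : ℝ) - 1) * ‖(Fᴴ * F) x y‖ ^ 2 = (n : ℝ) / m - 1 := by
  have hsq : (Fᴴ * F) * (Fᴴ * F) = (((n : ℝ) / m : ℝ) : ℂ) • (Fᴴ * F) := by
    rw [Matrix.mul_assoc, ← Matrix.mul_assoc F, hF.mul_conjTranspose hm]
    simp
  have hdiag := hF.gram_diag_eq_one x
  obtain ⟨ν, ρ, -, -, hG, -⟩ := hF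
  have h := congrFun (congrFun hsq x) x
  have hherm : ∀ j, (Fᴴ * F) x j * (Fᴴ * F) j x = ((‖(Fᴴ * F) x j‖ ^ 2 : ℝ) : ℂ) := by
    intro j
    have : (Fᴴ * F) j x = star ((Fᴴ * F) x j) := by
      rw [← Matrix.conjTranspose_apply, Matrix.conjTranspose_mul, Matrix.conjTranspose_conjTranspose]
    rw [this, Complex.star_def, Complex.mul_conj', Complex.ofReal_pow]
  rw [Matrix.mul_apply, Matrix.smul_apply, hdiag] at h
  simp_rw [hherm] at h
  rw [← Complex.ofReal_sum, smul_eq_mul, mul_one] at h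
  have h' := Complex.ofReal_injective h
  simp_rw [hG] at h'
  rw [← Finset.add_sum_erase _ _ (Finset.mem_univ x), if_pos rfl,
    Finset.sum_congr rfl (g := fun _ => ν ^ 2) (by
      intro j hj
      rw [if_neg (Finset.ne_of_mem_erase hj).symm]), Finset.sum_const,
    Finset.card_erase_of_mem (Finset.mem_univ x), Finset.card_univ, Fintype.card_fin,
    nsmul_eq_mul, Nat.cast_sub (by have := x.isLt; omega)] at h'
  rw [hG, if_neg hxy]
  push_cast at h'
  linarith

theorem IsETF.isFlat {m n : ℕ} {F : Matrix (Fin m) (Fin n) ℂ} (hF : IsETF F) (hm : m ≠ 0)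
    (hn : 2 ≤ n) (hρ : 1 < (n : ℝ) / m) :
    IsFlat (centralGram F ((n : ℝ) / m))
      (((2 - (n : ℝ) / m) / (2 * √((n : ℝ) / m - 1)) : ℝ) : ℂ)
      ((((n : ℝ) / m) ^ 2 / (4 * ((n : ℝ) / m - 1)) : ℝ) : ℂ) := by
  have hFF := hF.mul_conjTranspose hm
  have hoff := @IsETF.norm_sq_gram m n F hF hm
  set ρ := (n : ℝ) / m with hρdef
  have hb : 0 < √(ρ - 1) := Real.sqrt_pos.2 (by linarith)
  have hb2 : √(ρ - 1) ^ 2 = ρ - 1 := Real.sq_sqrt (by linarith)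
  refine ⟨hn, fun x => ?_, ?_, fun x y hxy => ?_⟩
  · rw [centralGram, Matrix.smul_apply, Matrix.sub_apply, Matrix.smul_apply, hF.gram_diag_eq_one,
      Matrix.one_apply_eq, smul_eq_mul, smul_eq_mul, mul_one, ← Complex.ofReal_inv,
      ← Complex.ofReal_one, ← Complex.ofReal_sub, ← Complex.ofReal_mul]
    congr 1
    field_simp
  · have hsq : (Fᴴ * F) * (Fᴴ * F) = ((ρ : ℝ) : ℂ) • (Fᴴ * F) := by
      rw [Matrix.mul_assoc, ← Matrix.mul_assoc F, hFF]
      simp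
    -- Completing the square in `G² = ρ G`; this is why the Gram matrix is centred at `ρ / 2`.
    have hcen : (Fᴴ * F - ((ρ / 2 : ℝ) : ℂ) • 1) * (Fᴴ * F - ((ρ / 2 : ℝ) : ℂ) • 1) =
        ((ρ ^ 2 / 4 : ℝ) : ℂ) • (1 : Matrix (Fin n) (Fin n) ℂ) := by
      rw [Matrix.sub_mul, Matrix.mul_sub, Matrix.mul_sub, hsq]
      simp only [Matrix.smul_mul, Matrix.mul_smul, Matrix.one_mul, Matrix.mul_one, smul_smul]
      rw [show ((ρ : ℝ) : ℂ) = ((ρ / 2 : ℝ) : ℂ) + ((ρ / 2 : ℝ) : ℂ) by push_cast; ring,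
        show ((ρ ^ 2 / 4 : ℝ) : ℂ) = ((ρ / 2 : ℝ) : ℂ) * ((ρ / 2 : ℝ) : ℂ) by push_cast; ring,
        add_smul]
      abel
    rw [centralGram, Matrix.smul_mul, Matrix.mul_smul, hcen, smul_smul, smul_smul]
    congr 1
    rw [← Complex.ofReal_inv, ← Complex.ofReal_mul, ← Complex.ofReal_mul]
    congr 1
    have h1 : ρ - 1 ≠ 0 := by linarith
    rw [← mul_inv, ← sq, hb2]
    field_simp
  · rw [centralGram, Matrix.smul_apply, Matrix.sub_apply, Matrix.smul_apply,
      Matrix.one_apply_ne hxy, smul_zero, sub_zero, smul_eq_mul, norm_mul, norm_inv,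
      Complex.norm_real, Real.norm_of_nonneg hb.le, mul_pow, inv_pow, hb2]
    have h := hoff hxy
    have hn' : (2 : ℝ) ≤ n := by exact_mod_cast hn
    have h1 : (0 : ℝ) < ρ - 1 := by linarith
    have h2 : ‖(Fᴴ * F) x y‖ ^ 2 = (ρ - 1) / (n - 1) := by
      rw [eq_div_iff (by linarith), ← h, mul_comm]
    -- What remains is `1 / (n - 1) ≤ 2 / n`, which holds for `n ≥ 2`.
    rw [h2, ← mul_div_assoc, inv_mul_cancel₀ h1.ne', div_le_div_iff₀ (by linarith) (by linarith)]
    linarith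

/-- The limit of the scalar `H * H` is the constant left over in `A_convolution` at `l = 1`; the
choice of `A γ 1` makes the two agree. -/
theorem A_one_sq (γ : ℝ) (h : 1 < γ⁻¹) :
    1 + A γ 1 ^ 2 = γ⁻¹ ^ 2 / (4 * (γ⁻¹ - 1)) := by
  have h1 : (0 : ℝ) < γ⁻¹ - 1 := by linarith
  rw [A_one, div_pow, mul_pow, Real.sq_sqrt h1.le]
  generalize γ⁻¹ = x at *
  have h2 := h1.ne'
  field_simp
  ring

end ETFMoments

/-! ### Passage to the limit along a sequence of frames -/

theorem mainTheorem3 (γ : ℝ) (hγ0 : 0 < γ) (hγ1 : γ < 1) (p : unitInterval)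
    (m n : ℕ → ℕ) (F : ∀ i, Matrix (Fin (m i)) (Fin (n i)) ℂ)
    (hF : ∀ i, ETFMoments.IsETF (F i))
    (hn : Tendsto n atTop atTop)
    (hγ : Tendsto (fun i => (m i : ℝ) / (n i : ℝ)) atTop (𝓝 γ))
    (r : ℕ) (hr : 1 ≤ r) :
    Tendsto (fun i => ETFMoments.expectedMoment (F i) p r) atTop
      (𝓝 ((ETFMoments.mStar r γ (p : ℝ) : ℝ) : ℂ)) := by
  open ETFMoments in
  have hinv : 1 < γ⁻¹ := (one_lt_inv₀ hγ0).2 hγ1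
  have hpos : 0 < γ⁻¹ - 1 := by linarith
  set ρ : ℕ → ℝ := fun i => (n i : ℝ) / (m i : ℝ) with hρdef
  have hρ : Tendsto ρ atTop (𝓝 γ⁻¹) := by
    refine (hγ.inv₀ hγ0.ne').congr fun i => ?_
    rw [inv_div]
  have hρ1 : ∀ᶠ i in atTop, 1 < ρ i := hρ.eventually (lt_mem_nhds hinv)
  have hgood : ∀ᶠ i in atTop, m i ≠ 0 ∧ 2 ≤ n i ∧ 1 < ρ i := by
    filter_upwards [hρ1, hn.eventually_ge_atTop 2] with i h1 h2
    -- If `m i = 0`, then `ρ i` is `0` by the convention for division by zero, contrary to `1 < ρ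
    -- i`.
    refine ⟨fun h => ?_, h2, h1⟩
    rw [hρdef] at h1
    simp only [h, Nat.cast_zero, div_zero] at h1
    linarith
  have hb : Tendsto (fun i => √(ρ i - 1)) atTop (𝓝 √(γ⁻¹ - 1)) :=
    (hρ.sub_const 1).sqrt
  have hb0 : √(γ⁻¹ - 1) ≠ 0 := (Real.sqrt_pos.2 hpos).ne'
  have hflat : ∀ᶠ i in atTop, IsFlat (centralGram (F i) (ρ i))
      (((2 - ρ i) / (2 * √(ρ i - 1)) : ℝ) : ℂ) ((ρ i ^ 2 / (4 * (ρ i - 1)) : ℝ) : ℂ) := by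
    filter_upwards [hgood] with i hi
    exact (hF i).isFlat hi.1 hi.2.1 hi.2.2
  have ha : Tendsto (fun i => (((2 - ρ i) / (2 * √(ρ i - 1)) : ℝ) : ℂ)) atTop
      (𝓝 ((A γ 1 : ℝ) : ℂ)) := by
    refine (Complex.continuous_ofReal.tendsto _).comp ?_
    rw [A_one]
    exact (hρ.const_sub 2).div (hb.const_mul 2) (mul_ne_zero two_ne_zero hb0)
  have hc : Tendsto (fun i => ((ρ i ^ 2 / (4 * (ρ i - 1)) : ℝ) : ℂ)) atTop
      (𝓝 ((1 + A γ 1 ^ 2 : ℝ) : ℂ)) := by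
    refine (Complex.continuous_ofReal.tendsto _).comp ?_
    rw [A_one_sq γ hinv]
    exact (hρ.pow 2).div ((hρ.sub_const 1).const_mul 4) (by positivity)
  have hcentral : ∀ j, 1 ≤ j → Tendsto (fun i => (1 / (n i : ℂ)) *
      ∫ S, ((centralGram (F i) (ρ i) * selection S) ^ j).trace
        ∂(setBernoulli (Set.univ : Set (Fin (n i))) p)) atTop
      (𝓝 ((mCentral j γ p : ℝ) : ℂ)) := by
    intro j hj
    obtain ⟨k, rfl⟩ : ∃ k, j = k + 1 := ⟨j - 1, by omega⟩
    simp_rw [integral_trace_pow]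
    rw [mCentral_eq, Complex.ofReal_sum]
    refine tendsto_finsetSum _ fun s _ => ?_
    rw [Complex.ofReal_mul, Complex.ofReal_pow]
    exact (tendsto_partitionSum hn hflat ha hc k s).const_mul _
  have hd : Tendsto (fun i => ((ρ i / 2 : ℝ) : ℂ)) atTop (𝓝 ((γ⁻¹ / 2 : ℝ) : ℂ)) :=
    (Complex.continuous_ofReal.tendsto _).comp (hρ.div_const 2)
  have hb' : Tendsto (fun i => ((√(ρ i - 1) : ℝ) : ℂ)) atTop (𝓝 ((√(γ⁻¹ - 1) : ℝ) : ℂ)) :=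
    (Complex.continuous_ofReal.tendsto _).comp hb
  have hlim := ((hd.pow r).mul_const (p : ℂ)).add
    (tendsto_finsetSum (Finset.Icc 1 r) fun j hj =>
      (((hb'.pow j).mul (hd.pow (r - j))).mul
        (hcentral j (Finset.mem_Icc.1 hj).1)).const_mul (r.choose j : ℂ))
  have hval : ((mStar r γ (p : ℝ) : ℝ) : ℂ) = ((γ⁻¹ / 2 : ℝ) : ℂ) ^ r * (p : ℂ) +
      ∑ j ∈ Finset.Icc 1 r, (r.choose j : ℂ) * (((√(γ⁻¹ - 1) : ℝ) : ℂ) ^ j *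
        ((γ⁻¹ / 2 : ℝ) : ℂ) ^ (r - j) * ((mCentral j γ p : ℝ) : ℂ)) := by
    have hK : ∀ j : ℕ, (γ⁻¹ - 1) ^ ((j : ℝ) / 2) = √(γ⁻¹ - 1) ^ j := by
      intro j
      rw [Real.sqrt_eq_rpow, ← Real.rpow_natCast, ← Real.rpow_mul hpos.le]
      congr 1
      ring
    simp only [mStar, K, hK]
    push_cast
    rfl
  rw [hval]
  refine hlim.congr' ?_
  filter_upwards [hgood] with i hi
  rw [expectedMoment_eq (by omega) (gram_eq (F i) hi.2.2) p hr]
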